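/- **Definitions.** Let $G=(V,E)$ be a finite directed graph with $n=|V|$ vertices, given by adjacency lists, with edge weights $w$; let $d_G(u,v)\in[0,\infty]$ be the infimum of the weights of the directed walks from $u$ to $v$, and let $\deg(v)$ be the length of the edge list of $v$ (its out-degree). For $0\le\alpha\le1$, a function $d:V\to[0,\infty]$ is *$\alpha$-distance-preserving* from a source $s$ if $\alpha\, d_G(s,u)\le d(u)\le d_G(s,u)$ and $d(v)\le d(u)+d_G(u,v)$ (that is, $d(v)-d(u)\le d_G(u,v)$) for all $u,v\in V$. The *bucket-tree structure* is a complete binary tree whose nodes ("buckets") are labelled $0,1,2,\dots$ in in-order, so that level $\ell\ge1$ (level 1 being the leaves) consists of the labels $B$ such that $2^{\ell-1}$ is the largest power of $2$ dividing $B+1$. The *frontier buckets* of a current bucket $c$ are, for each level, the bucket with the smallest label $>c$ on that level. The bucket-tree variant of Dijkstra's algorithm first inserts $s$ into bucket $0$. It then repeatedly visits an unvisited vertex $u$ that lies in the bucket $c$ of smallest label among all unvisited inserted vertices (ties broken arbitrarily), and relaxes every edge $(u,v)$ as follows: with $r=\lfloor\log_2(w(u,v)+1)\rfloor$, let $B$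 be the frontier bucket of $c$ with the largest label such that $B-c\le 2^r-1$; the vertex $v$ is moved to $B$ if it has not been inserted yet or if its present label is larger than $B$. The algorithm ends when no unvisited inserted vertex is left. Let $d(v)$ be the final label of $v$, and $d(v)=\infty$ if $v$ was never inserted. The machine is a random-access machine with words of $O(\log n)$ bits, with unit-cost arithmetic and bitwise operations, comparison, $\lfloor\log_2\cdot\rfloor$ of a word, and the integer part of an input edge weight. The adjacency lists are stored in its memory, the weights are in a read-only array of real numbers, and all other cells are initially zero. **Theorem.** Let $k\in\mathbb N$ be a constant. There are a program and a constant $C$, depending only on $k$, such that for every $n$, every weighted directed graph $G$ with $n$ vertices and edge weights in $[1,n^k]$, and every source $s$, the program, started on $(G,s)$, halts, and the following holds for some run of the bucket-tree variant of Dijkstra's algorithm, with visited vertices $v_1,\dots,v_K$ (in this order) and labels $d$: 1. $d$ is $\tfrac14$-distance-preserving from $s$: $\tfrac14 d_G(s,u)\le d(u)\le d_G(s,u)$ and $d(v)\le d(u)+d_G(u,v)$ for all $u,v\in V$; 2. $v_1,\dots,v_K$ are distinct, they are exactly the vertices reachable from $s$, and $d(v_1)\le d(v_2)\le\dots\le d(v_K)$;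 3. the program outputs exactly the pairs $(v_1,d(v_1)),\dots,(v_K,d(v_K))$, in this order; for every $j\le K$, the $j$-th pair is output after at most $C\,\bigl(1+\sum_{i=1}^{j}\deg(v_i)\bigr)$ steps, and the program halts after at most $C\,\bigl(1+\sum_{i=1}^{K}\deg(v_i)\bigr)$ steps. -/

import Mathlib

open scoped NNReal ENNReal

noncomputable section

namespace BucketSSSP

/-! ### Weighted directed graphs -/

/-- A finite weighted directed graph on the vertices `0, …, n - 1`, given by its adjacency lists
(in an arbitrary order): there is an edge from `u` to `v` iff `v ∈ adj u`, and its weight is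
`weight u v`.  No edge is listed twice. -/
structure WDigraph (n : ℕ) where
  adj : Fin n → List (Fin n)
  nodup : ∀ u, (adj u).Nodup
  weight : Fin n → Fin n → ℝ≥0

namespace WDigraph

variable {n : ℕ} (G : WDigraph n)

/-- The length of the edge list of `u`. -/
def degree (u : Fin n) : ℕ := (G.adj u).length

/-- `G.IsWalk u v ℓ`: there is a directed walk of total weight `ℓ` from `u` to `v`. -/
inductive IsWalk : Fin n → Fin n → ℝ≥0 → Prop
  | nil (u : Fin n) : IsWalk u u 0
  | cons {u v x : Fin n} {ℓ : ℝ≥0} : v ∈ G.adj u → IsWalk v x ℓ → IsWalk u x (G.weight u v + ℓ)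

/-- The shortest-path distance `d_G(u, v)`, equal to `∞` if `v` is not reachable from `u`. -/
def dist (u v : Fin n) : ℝ≥0∞ := ⨅ (ℓ : ℝ≥0) (_ : G.IsWalk u v ℓ), (ℓ : ℝ≥0∞)

/-- `α`-distance-preserving single-source distances from `s`.  The inequality
`d(v) - d(u) ≤ d_G(u, v)` is written additively, because distances may be infinite. -/
def DistancePreserving (α : ℝ≥0∞) (s : Fin n) (d : Fin n → ℝ≥0∞) : Prop :=
  α ≤ 1 ∧ (∀ u, α * G.dist s u ≤ d u ∧ d u ≤ G.dist s u) ∧ ∀ u v, d v ≤ d u + G.dist u v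

end WDigraph

/-! ### The bucket-tree structure and the variant of Dijkstra's algorithm that uses it -/

/-- The buckets are the nodes of a complete binary tree, labelled `0, 1, 2, …` in in-order; the
label is the distance to the source that the bucket stands for.  The leaves (level 1) are the
even labels, level 2 consists of `1, 5, 9, …`, level 3 of `3, 11, 19, …`, and so on. -/
def level (B : ℕ) : ℕ := padicValNat 2 (B + 1) + 1

/-- `B` is a frontier bucket for the current bucket `c`: it is the left-most bucket of its level
whose label is larger than `c`. -/
def IsFrontier (c B : ℕ) : Prop := c < B ∧ ∀ B', c < B' → level B' = level B → B ≤ B'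

open scoped Classical in
/-- The bucket into which an edge of weight `x`, relaxed from the current bucket `c`, inserts its
head: with `r = ⌊log₂ (x + 1)⌋`, the frontier bucket whose distance from `c` is the closest to,
but no more than, `2 ^ r - 1`. -/
def insertBucket (c : ℕ) (x : ℝ≥0) : ℕ :=
  Nat.findGreatest (IsFrontier c) (c + (2 ^ ⌊Real.logb 2 ((x : ℝ) + 1)⌋₊ - 1))

open scoped Classical in
/-- Relaxation of all edges that leave `u`.  Here `t v` is the label of the bucket that holds
`v` (`⊤` if `v` has not been inserted yet); a vertex is moved whenever this decreases it. -/
def relax {n : ℕ} (G : WDigraph n) (t : Fin n → ℕ∞) (u : Fin n) : Fin n → ℕ∞ := fun v =>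
  if v ∈ G.adj u then min (t v) (insertBucket (t u).toNat (G.weight u v) : ℕ∞) else t v

/-- `PartialRun G s l t`: Dijkstra's algorithm on the bucket-tree structure, started at `s`, can
visit the vertices of `l` in this order, and then has the bucket labels `t`. Ties between vertices
in the same bucket may be broken arbitrarily. -/
inductive PartialRun {n : ℕ} (G : WDigraph n) (s : Fin n) : List (Fin n) → (Fin n → ℕ∞) → Prop
  | start : PartialRun G s [] (fun v => if v = s then 0 else ⊤)
  | visit {l : List (Fin n)} {t : Fin n → ℕ∞} {u : Fin n} :
      PartialRun G s l t → u ∉ l → t u ≠ ⊤ → (∀ v, v ∉ l → t u ≤ t v) →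
      PartialRun G s (l ++ [u]) (relax G t u)

/-- A complete run: it ends when all buckets are empty. -/
def CompleteRun {n : ℕ} (G : WDigraph n) (s : Fin n) (l : List (Fin n)) (d : Fin n → ℕ∞) : Prop :=
  PartialRun G s l d ∧ ∀ v, v ∉ l → d v = ⊤

/-! ### The random-access machine -/

/-- Binary operations on machine words (subtraction is truncated, division rounds down). -/
inductive BinOp
  | add | sub | mul | div | land | lor | xor | shl | shr

def BinOp.eval : BinOp → ℕ → ℕ → ℕ
  | .add, x, y => x + y
  | .sub, x, y => x - y
  | .mul, x, y => x * y
  | .div, x, y => x / y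
  | .land, x, y => x &&& y
  | .lor, x, y => x ||| y
  | .xor, x, y => x ^^^ y
  | .shl, x, y => x <<< y
  | .shr, x, y => x >>> y

/-- Programs of the machine, over registers `R[0], R[1], …` (each program mentions finitely many),
a memory `M[0], M[1], …` of words, and a read-only input array `W[0], W[1], …` of real numbers,
which can be accessed only through their integer parts. -/
inductive Program
  /-- `R[d] := v` -/
  | const (d v : ℕ)
  /-- `R[d] := o (R[a], R[b])` -/
  | op (o : BinOp) (d a b : ℕ)
  /-- `R[d] := ⌊log₂ R[a]⌋` -/
  | log (d a : ℕ)
  /-- `R[d] := ⌊W[R[a]]⌋` -/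
  | floor (d a : ℕ)
  /-- `R[d] := M[R[a]]` -/
  | load (d a : ℕ)
  /-- `M[R[a]] := R[b]` -/
  | store (a b : ℕ)
  /-- output the pair `(R[a], R[b])` -/
  | output (a b : ℕ)
  /-- do nothing -/
  | skip
  /-- first `p`, then `q` -/
  | seq (p q : Program)
  /-- `if R[a] < R[b] then p else q` -/
  | ifLt (a b : ℕ) (p q : Program)
  /-- `while R[a] < R[b] do p` -/
  | whileLt (a b : ℕ) (p : Program)

/-- A configuration of the machine: registers, memory, the number of steps made so far, and the
pairs that were output so far, in this order, each preceded by the time of its output. -/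
@[ext] structure Config where
  reg : ℕ → ℕ
  mem : ℕ → ℕ
  time : ℕ
  out : List (ℕ × ℕ × ℕ)

namespace Config

def setReg (σ : Config) (d v : ℕ) : Config :=
  { σ with reg := Function.update σ.reg d v, time := σ.time + 1 }

def setMem (σ : Config) (a v : ℕ) : Config :=
  { σ with mem := Function.update σ.mem a v, time := σ.time + 1 }

def emit (σ : Config) (x y : ℕ) : Config :=
  { σ with time := σ.time + 1, out := σ.out ++ [(σ.time + 1, x, y)] }

def tick (σ : Config) : Config := { σ with time := σ.time + 1 }

end Config

/-- `Exec w W p σ τ`: with word size `w` and real input `W`, the program `p`, started in `σ`,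
terminates in `τ`.  Every basic operation and every test takes one step.  An operation whose result
does not fit into a word of `w` bits has no execution. -/
inductive Exec (w : ℕ) (W : ℕ → ℝ≥0) : Program → Config → Config → Prop
  | const {σ : Config} {d v : ℕ} : v < 2 ^ w → Exec w W (.const d v) σ (σ.setReg d v)
  | op {σ : Config} {o : BinOp} {d a b : ℕ} : o.eval (σ.reg a) (σ.reg b) < 2 ^ w →
      Exec w W (.op o d a b) σ (σ.setReg d (o.eval (σ.reg a) (σ.reg b)))
  | log {σ : Config} {d a : ℕ} : Nat.log 2 (σ.reg a) < 2 ^ w →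
      Exec w W (.log d a) σ (σ.setReg d (Nat.log 2 (σ.reg a)))
  | floor {σ : Config} {d a : ℕ} : ⌊W (σ.reg a)⌋₊ < 2 ^ w →
      Exec w W (.floor d a) σ (σ.setReg d ⌊W (σ.reg a)⌋₊)
  | load {σ : Config} {d a : ℕ} : σ.mem (σ.reg a) < 2 ^ w →
      Exec w W (.load d a) σ (σ.setReg d (σ.mem (σ.reg a)))
  | store {σ : Config} {a b : ℕ} : Exec w W (.store a b) σ (σ.setMem (σ.reg a) (σ.reg b))
  | output {σ : Config} {a b : ℕ} : Exec w W (.output a b) σ (σ.emit (σ.reg a) (σ.reg b))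
  | skip {σ : Config} : Exec w W .skip σ σ.tick
  | seq {σ τ υ : Config} {p q : Program} :
      Exec w W p σ τ → Exec w W q τ υ → Exec w W (.seq p q) σ υ
  | ifTrue {σ τ : Config} {a b : ℕ} {p q : Program} : σ.reg a < σ.reg b →
      Exec w W p σ.tick τ → Exec w W (.ifLt a b p q) σ τ
  | ifFalse {σ τ : Config} {a b : ℕ} {p q : Program} : ¬ σ.reg a < σ.reg b →
      Exec w W q σ.tick τ → Exec w W (.ifLt a b p q) σ τ
  | whileTrue {σ τ υ : Config} {a b : ℕ} {p : Program} : σ.reg a < σ.reg b →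
      Exec w W p σ.tick τ → Exec w W (.whileLt a b p) τ υ → Exec w W (.whileLt a b p) σ υ
  | whileFalse {σ : Config} {a b : ℕ} {p : Program} : ¬ σ.reg a < σ.reg b →
      Exec w W (.whileLt a b p) σ σ.tick

/-! ### The input -/

namespace WDigraph

variable {n : ℕ} (G : WDigraph n)

/-- All edges, as pairs (tail, head), the edge lists of the vertices being concatenated. -/
def edges : List (Fin n × Fin n) :=
  (List.finRange n).flatMap fun u => (G.adj u).map fun v => (u, v)

/-- The edge list of the vertex `i` occupies the positions `G.offset i`, …, `G.offset (i + 1) - 1`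
of the list of all edges. -/
def offset (i : ℕ) : ℕ := (((List.finRange n).take i).map G.degree).sum

/-- The initial memory: the number `n` of vertices, the source, the `n + 1` offsets, and the
heads of the edges.  All other cells are zero. -/
def inputMem (s : Fin n) : ℕ → ℕ := fun i =>
  ([n, (s : ℕ)] ++ (List.range (n + 1)).map G.offset
    ++ G.edges.map fun e => (e.2 : ℕ)).getD i 0

/-- The real input array: the weights of the edges, in the same order. -/
def inputWeights : ℕ → ℝ≥0 := fun i => (G.edges.map fun e => G.weight e.1 e.2).getD i 0

/-- The initial configuration. -/
def input (s : Fin n) : Config where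
  reg := fun _ => 0
  mem := G.inputMem s
  time := 0
  out := []

end WDigraph

end BucketSSSP

end

open BucketSSSP

namespace BucketSSSP

/-! ### Arithmetic of bucket labels -/

/-! Distances. After all labels are shifted by one, level `j + 1` consists of the numbers of 2-adic
valuation `j`, and its frontier bucket is the only such number among the `2 ^ (j + 1)` numbers after
the current one. The insertion rule then has a closed form: round the current label `c` down to a
multiple of `2 ^ q`, where `q = r - 1`, and go two multiples further (`insertBucket_eq`). So an edge
of weight `x ≥ 1` advances the label by at least one, by at least `x / 4` and by at most `⌊x⌋`. The
first bound freezes the labels of visited vertices, as in Dijkstra's algorithm; the second makes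
every finite label `d(v)` witness a walk of weight at most `4 d(v)`; the third telescopes along
walks to `d(v) ≤ d(u) + d_G(u, v)` (`PartialRun.facts`, `CompleteRun.distancePreserving`).

Running time. A frontier bucket remains one until the current bucket reaches it, so one linked list
per level is enough, with a bit mask of the non-empty levels. Every relaxation simply prepends an
entry. Labels are not stored, old entries are not deleted, and a flag tells which vertices are
visited: an unvisited vertex found in the current bucket has the current label (`QueueInv.head_eq`).
The next non-empty bucket is found by constantly many word operations, since with `i` the lowest set
bit of the mask only the next two multiples of `2 ^ i` are candidates (`lab_eq_nextMultiple`,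
`lab_eq_nextMultiple_add`).

Each relaxed edge creates one entry and each entry is removed at most once, so charging a constant
to every entry in the queue gives both time bounds (`wp_loopBody`). -/

theorem padicValNat_two_eq_iff {b j : ℕ} : padicValNat 2 b = j ∧ b ≠ 0 ↔ b % 2 ^ (j + 1) = 2 ^ j := by
  have hlt : 2 ^ j < 2 ^ (j + 1) := Nat.pow_lt_pow_right (by norm_num) (by omega)
  constructor
  · rintro ⟨rfl, hb⟩
    obtain ⟨q, hq⟩ := @pow_padicValNat_dvd 2 b
    have hnd := pow_succ_padicValNat_not_dvd (p := 2) hb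
    set j := padicValNat 2 b
    have hodd : q % 2 = 1 := by
      by_contra h
      apply hnd
      obtain ⟨z, hz⟩ : 2 ∣ q := by omega
      exact ⟨z, by rw [hq, hz, pow_succ]; ring⟩
    rw [hq, pow_succ, Nat.mul_mod_mul_left, hodd, mul_one]
  · intro h
    have hb : b ≠ 0 := by
      rintro rfl
      simp at h
      have := Nat.pos_of_ne_zero (pow_ne_zero j (two_ne_zero : (2 : ℕ) ≠ 0))
      omega
    refine ⟨?_, hb⟩
    apply le_antisymm
    · by_contra hlt'
      push Not at hlt'
      have : 2 ^ (j + 1) ∣ b := (pow_dvd_pow 2 hlt').trans pow_padicValNat_dvd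
      rw [Nat.mod_eq_zero_of_dvd this] at h
      have := Nat.pos_of_ne_zero (pow_ne_zero j (two_ne_zero : (2 : ℕ) ≠ 0))
      omega
    · refine (padicValNat_dvd_iff_le hb).mp ?_
      rw [← Nat.div_add_mod b (2 ^ (j + 1)), h]
      exact dvd_add ((pow_dvd_pow 2 (Nat.le_succ j)).mul_right _) dvd_rfl

/-- `b` is the shifted label of a bucket of level `j + 1` that is a frontier bucket for the bucket
with the shifted label `a`; the label of a bucket is shifted by adding one to it. -/
def FrontierAt (a j b : ℕ) : Prop := b % 2 ^ (j + 1) = 2 ^ j ∧ a < b ∧ b ≤ a + 2 ^ (j + 1)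

theorem sub_ge_of_mod_eq {j b b' : ℕ} (h : b % 2 ^ (j + 1) = b' % 2 ^ (j + 1)) (hlt : b' < b) :
    b' + 2 ^ (j + 1) ≤ b := by
  have h1 := (Nat.modEq_iff_dvd' hlt.le).mp (show b' ≡ b [MOD 2 ^ (j + 1)] from h.symm)
  have := Nat.le_of_dvd (by omega) h1
  omega

/-- Labels of one level are `2 ^ (j + 1)` apart, and the window after `a` has just this length. This
is why one list per level suffices. -/
theorem FrontierAt.unique {a j b b' : ℕ} (h : FrontierAt a j b) (h' : FrontierAt a j b') :
    b = b' := by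
  obtain ⟨h1, h2, h3⟩ := h
  obtain ⟨h1', h2', h3'⟩ := h'
  rcases lt_trichotomy b b' with hlt | h | hlt
  · have := sub_ge_of_mod_eq (h1'.trans h1.symm) hlt
    omega
  · exact h
  · have := sub_ge_of_mod_eq (h1.trans h1'.symm) hlt
    omega

theorem FrontierAt.pow_le {a j b : ℕ} (h : FrontierAt a j b) : 2 ^ j ≤ b :=
  h.1 ▸ Nat.mod_le b _

theorem FrontierAt.pow_dvd {a j b : ℕ} (h : FrontierAt a j b) : 2 ^ j ∣ b := by
  rw [← (padicValNat_two_eq_iff.mpr h.1).1]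
  exact pow_padicValNat_dvd

/-- The frontier bucket of a level stays the same while the current bucket stays below it. -/
theorem FrontierAt.mono {a a' j b : ℕ} (h : FrontierAt a j b) (h1 : a ≤ a') (h2 : a' < b) :
    FrontierAt a' j b :=
  ⟨h.1, h2, h.2.2.trans (by omega)⟩

theorem FrontierAt.level_unique {a a' j j' b : ℕ} (h : FrontierAt a j b) (h' : FrontierAt a' j' b) :
    j = j' :=
  (padicValNat_two_eq_iff.mpr h.1).1.symm.trans (padicValNat_two_eq_iff.mpr h'.1).1

/-- If `B` lay more than one period after `c`, the bucket one period to its left would have the same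
level and still exceed `c`. -/
theorem isFrontier_iff {c B : ℕ} :
    IsFrontier c B ↔ FrontierAt (c + 1) (padicValNat 2 (B + 1)) (B + 1) := by
  have hB := padicValNat_two_eq_iff.mp ⟨rfl, B.succ_ne_zero⟩
  simp only [Nat.succ_eq_add_one] at hB
  set j := padicValNat 2 (B + 1) with hj
  constructor
  · rintro ⟨h1, h2⟩
    refine ⟨hB, by omega, ?_⟩
    by_contra hlt
    push Not at hlt
    have hpos : 0 < 2 ^ (j + 1) := by positivity
    have h3 : (B - 2 ^ (j + 1) + 1) % 2 ^ (j + 1) = 2 ^ j := by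
      rw [← hB, ← Nat.add_mod_right (B - 2 ^ (j + 1) + 1)]
      congr 1
      omega
    have := h2 (B - 2 ^ (j + 1)) (by omega) (by
      unfold level
      rw [(padicValNat_two_eq_iff.mpr h3).1])
    omega
  · rintro ⟨-, h2, h3⟩
    refine ⟨by omega, fun B' h4 h5 => ?_⟩
    unfold level at h5
    by_contra hlt
    have hB' := padicValNat_two_eq_iff.mp ⟨rfl, B'.succ_ne_zero⟩
    simp only [Nat.succ_eq_add_one] at hB'
    rw [show padicValNat 2 (B' + 1) = j by omega] at hB'
    have := sub_ge_of_mod_eq (hB.trans hB'.symm) (by omega)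
    omega

/-- The shifted label of the bucket into which an edge is inserted from the bucket `c`, where
`2 ^ (q + 1)` is the largest power of two that does not exceed the weight plus one. -/
def insertLabel (c q : ℕ) : ℕ := (c / 2 ^ q + 2) * 2 ^ q

/-- Rounding down loses less than `2 ^ q`, which the first of the two added multiples makes up for.
-/
theorem insertLabel_gt (c q : ℕ) : c + 2 ^ q < insertLabel c q := by
  have h1 := Nat.div_add_mod c (2 ^ q)
  have h2 := Nat.mod_lt c (show 0 < 2 ^ q by positivity)
  unfold insertLabel
  nlinarith

theorem insertLabel_le (c q : ℕ) : insertLabel c q ≤ c + 2 ^ (q + 1) := by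
  have h1 := Nat.div_mul_le_self c (2 ^ q)
  unfold insertLabel
  rw [pow_succ, add_mul]
  omega

/-- A multiple of `2 ^ q` has level at least `q + 1`, so the period of its level is at least `2 ^ (q
+ 1)`, which bounds its distance from `c`. -/
theorem insertLabel_frontierAt (c q : ℕ) :
    FrontierAt (c + 1) (padicValNat 2 (insertLabel c q)) (insertLabel c q) := by
  have h1 := insertLabel_gt c q
  have h2 := insertLabel_le c q
  have h0 : 0 < 2 ^ q := by positivity
  have hq : q ≤ padicValNat 2 (insertLabel c q) :=
    (padicValNat_dvd_iff_le (by omega)).mp (Dvd.intro_left _ rfl)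
  refine ⟨padicValNat_two_eq_iff.mp ⟨rfl, by omega⟩, by omega, ?_⟩
  have := Nat.pow_le_pow_right (show 0 < 2 by norm_num) (show q + 1 ≤ _ from Nat.succ_le_succ hq)
  simp only [Nat.succ_eq_add_one] at this
  omega

/-- Powers of two are integers, so comparing them with `x + 1` or with `⌊x⌋₊ + 1` is the same. Hence
the machine needs only the integer part of a weight. -/
theorem floor_logb_two (x : ℝ≥0) :
    ⌊Real.logb 2 ((x : ℝ) + 1)⌋₊ = Nat.log 2 (⌊x⌋₊ + 1) := by
  have hx : (0 : ℝ) < (x : ℝ) + 1 := by positivity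
  have hx1 : (1 : ℝ) ≤ (x : ℝ) + 1 := by simp
  symm
  rw [Nat.log_eq_iff (Or.inr ⟨by norm_num, by omega⟩)]
  have key : ∀ r : ℕ, 2 ^ r ≤ ⌊x⌋₊ + 1 ↔ (r : ℝ) ≤ Real.logb 2 ((x : ℝ) + 1) := by
    intro r
    rw [Real.le_logb_iff_rpow_le (by norm_num) hx, Real.rpow_natCast, ← Nat.floor_add_one (by simp),
      Nat.le_floor_iff (by simp), ← NNReal.coe_le_coe]
    push_cast
    rfl
  have h0 : 0 ≤ Real.logb 2 ((x : ℝ) + 1) := Real.logb_nonneg (by norm_num) hx1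
  constructor
  · rw [key]
    exact Nat.floor_le h0
  · by_contra h
    push Not at h
    rw [key] at h
    have := Nat.lt_floor_add_one (Real.logb 2 ((x : ℝ) + 1))
    push_cast at h
    linarith

theorem one_le_log_floor {x : ℝ≥0} (hx : 1 ≤ x) : 1 ≤ Nat.log 2 (⌊x⌋₊ + 1) := by
  have : 1 ≤ ⌊x⌋₊ := Nat.le_floor (by simpa using hx)
  exact Nat.log_pos (by norm_num) (by omega)

/-- The exponent `q` of `insertLabel` for an edge of weight `x`. -/
noncomputable def weightExp (x : ℝ≥0) : ℕ := Nat.log 2 (⌊x⌋₊ + 1) - 1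

theorem weightExp_pow_le {x : ℝ≥0} (hx : 1 ≤ x) : 2 ^ (weightExp x + 1) ≤ ⌊x⌋₊ + 1 := by
  have := one_le_log_floor hx
  rw [weightExp, Nat.sub_add_cancel this]
  exact Nat.pow_log_le_self 2 (by omega)

theorem lt_weightExp_pow {x : ℝ≥0} (hx : 1 ≤ x) : ⌊x⌋₊ + 1 < 2 ^ (weightExp x + 2) := by
  have := one_le_log_floor hx
  rw [weightExp, show Nat.log 2 (⌊x⌋₊ + 1) - 1 + 2 = (Nat.log 2 (⌊x⌋₊ + 1)).succ by omega]
  exact Nat.lt_pow_succ_log_self (by norm_num) _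

/-- For maximality, consider a larger frontier bucket within the allowed distance. If its valuation
is less than `q`, it is too close to `c`; otherwise its shifted label is a multiple of `2 ^ q`
strictly between two consecutive multiples. -/
theorem insertBucket_eq {c : ℕ} {x : ℝ≥0} (hx : 1 ≤ x) :
    insertBucket c x + 1 = insertLabel c (weightExp x) := by
  classical
  have hr := one_le_log_floor hx
  unfold insertBucket
  rw [floor_logb_two, show Nat.log 2 (⌊x⌋₊ + 1) = weightExp x + 1 by unfold weightExp; omega]
  set q := weightExp x
  have h1 := insertLabel_gt c q
  have h2 := insertLabel_le c q
  have h3 := insertLabel_frontierAt c q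
  have h4 : 0 < 2 ^ q := by positivity
  obtain ⟨B, hB⟩ : ∃ B, insertLabel c q = B + 1 := ⟨insertLabel c q - 1, by omega⟩
  rw [hB] at h1 h2 h3 ⊢
  congr 1
  rw [Nat.findGreatest_eq_iff]
  refine ⟨by omega, fun _ => isFrontier_iff.mpr h3, fun B' h5 h6 h7 => ?_⟩
  obtain ⟨h8, h9, h10⟩ := isFrontier_iff.mp h7
  set j := padicValNat 2 (B' + 1) with hj
  rcases lt_or_ge j q with hlt | hge
  · have := Nat.pow_le_pow_right (show 0 < 2 by norm_num) (show j + 1 ≤ q from hlt)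
    omega
  · have hd : 2 ^ q ∣ B' + 1 := (pow_dvd_pow 2 hge).trans (hj ▸ pow_padicValNat_dvd)
    obtain ⟨z, hz⟩ := hd
    have h11 : B' + 1 < (c / 2 ^ q + 3) * 2 ^ q := by
      have e1 := Nat.div_add_mod c (2 ^ q)
      have e2 := Nat.mod_lt c h4
      rw [pow_succ] at h6
      have : B' + 1 ≤ c + 2 ^ q * 2 := by omega
      nlinarith
    have h12 : (c / 2 ^ q + 2) * 2 ^ q < B' + 1 := by
      have : insertLabel c q < B' + 1 := by omega
      exact this
    rw [hz, mul_comm (2 ^ q) z] at h11 h12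
    have := Nat.lt_of_mul_lt_mul_right h11
    have := Nat.lt_of_mul_lt_mul_right h12
    omega

theorem lt_insertBucket {c : ℕ} {x : ℝ≥0} (hx : 1 ≤ x) : c < insertBucket c x := by
  have h1 := insertLabel_gt c (weightExp x)
  have h4 : 0 < 2 ^ weightExp x := by positivity
  have := insertBucket_eq (c := c) hx
  omega

theorem insertBucket_le {c : ℕ} {x : ℝ≥0} (hx : 1 ≤ x) : insertBucket c x ≤ c + ⌊x⌋₊ := by
  have h1 := insertLabel_le c (weightExp x)
  have h4 := weightExp_pow_le hx
  have := insertBucket_eq (c := c) hx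
  omega

/-- The label advances by at least `2 ^ q`, while `x < 2 ^ (q + 2)`. This is the origin of the ratio
`1 / 4`. -/
theorem le_insertBucket {c : ℕ} {x : ℝ≥0} (hx : 1 ≤ x) :
    4 * (c : ℝ≥0) + x ≤ 4 * (insertBucket c x : ℝ≥0) := by
  have h1 := insertLabel_gt c (weightExp x)
  have h2 := insertBucket_eq (c := c) hx
  have h3 := lt_weightExp_pow hx
  rw [pow_add] at h3
  have h5 : x ≤ ((⌊x⌋₊ + 1 : ℕ) : ℝ≥0) := by
    push_cast
    exact (Nat.lt_floor_add_one x).le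
  have h6 : 4 * c + (⌊x⌋₊ + 1) ≤ 4 * insertBucket c x := by omega
  calc 4 * (c : ℝ≥0) + x ≤ 4 * (c : ℝ≥0) + ((⌊x⌋₊ + 1 : ℕ) : ℝ≥0) := by gcongr
    _ ≤ _ := by exact_mod_cast h6

/-- The number of trailing zeros of a positive number, computed by machine operations. -/
theorem log_xor_pred {b : ℕ} (hb : b ≠ 0) : Nat.log 2 (b ^^^ (b - 1)) = padicValNat 2 b := by
  induction b using Nat.strong_induction_on with
  | _ b ih =>
    rcases Nat.even_or_odd' b with ⟨y, rfl | rfl⟩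
    · have hy : y ≠ 0 := by omega
      -- The two numbers differ in the last bit, and halving turns them into `y` and `y - 1`.
      have h1 : (2 * y) ^^^ (2 * y - 1) = 2 * (y ^^^ (y - 1)) + 1 := by
        apply Nat.eq_of_testBit_eq
        intro i
        cases i with
        | zero => simp; omega
        | succ i =>
          rw [Nat.testBit_xor, Nat.testBit_succ, Nat.testBit_succ, Nat.testBit_succ,
            show 2 * y / 2 = y by omega, show (2 * y - 1) / 2 = y - 1 by omega,
            show (2 * (y ^^^ (y - 1)) + 1) / 2 = y ^^^ (y - 1) by omega, Nat.testBit_xor]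
      have h2 : y ^^^ (y - 1) ≠ 0 := by
        intro h
        have := Nat.xor_eq_zero_iff.mp h
        omega
      rw [h1, padicValNat.mul two_ne_zero hy, padicValNat_self, ← ih y (by omega) hy,
        Nat.log_of_one_lt_of_le (by norm_num) (by omega), add_comm]
      congr 2
      omega
    · have h1 : (2 * y + 1) ^^^ (2 * y + 1 - 1) = 1 := by
        apply Nat.eq_of_testBit_eq
        intro i
        cases i with
        | zero => simp
        | succ i =>
          rw [Nat.testBit_xor, Nat.testBit_succ, Nat.testBit_succ, Nat.testBit_succ,
            show (2 * y + 1) / 2 = y by omega, show (2 * y + 1 - 1) / 2 = y by omega]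
          simp
      rw [h1, padicValNat.eq_zero_of_not_dvd (by omega)]
      simp

/-! ### Properties of the runs -/

section Runs

variable {n : ℕ} {G : WDigraph n}

theorem WDigraph.IsWalk.snoc {u v x : Fin n} {ℓ : ℝ≥0} (h : G.IsWalk u v ℓ) (hx : x ∈ G.adj v) :
    G.IsWalk u x (ℓ + G.weight v x) := by
  induction h with
  | nil u =>
    have := WDigraph.IsWalk.cons hx (WDigraph.IsWalk.nil x)
    rwa [add_comm] at this
  | cons hv _ ih =>
    have := WDigraph.IsWalk.cons hv (ih hx)
    rwa [← add_assoc] at this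

theorem relax_le (t : Fin n → ℕ∞) (u v : Fin n) : relax G t u v ≤ t v := by
  unfold relax
  split_ifs
  · exact min_le_left _ _
  · exact le_rfl

theorem le_relax (hw : ∀ u, ∀ v ∈ G.adj u, 1 ≤ G.weight u v) {t : Fin n → ℕ∞} {u v : Fin n}
    (hu : t u ≠ ⊤) (h : t u ≤ t v) : t u ≤ relax G t u v := by
  unfold relax
  split_ifs with hv
  · refine le_min h ?_
    obtain ⟨c, hc⟩ := ENat.ne_top_iff_exists.mp hu
    rw [← hc]
    exact_mod_cast (lt_insertBucket (hw u v hv)).le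
  · exact h

/-- A relaxation only assigns labels larger than the current one, so no label up to the current one
can decrease. -/
theorem relax_eq (hw : ∀ u, ∀ v ∈ G.adj u, 1 ≤ G.weight u v) {t : Fin n → ℕ∞} {u v : Fin n}
    (hu : t u ≠ ⊤) (h : t v ≤ t u) : relax G t u v = t v := by
  unfold relax
  split_ifs with hv
  · refine min_eq_left (h.trans ?_)
    obtain ⟨c, hc⟩ := ENat.ne_top_iff_exists.mp hu
    rw [← hc]
    exact_mod_cast (lt_insertBucket (hw u v hv)).le
  · rfl

/-- What holds after every step of a run, if all weights are between `1` and `N`. -/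
structure RunFacts (G : WDigraph n) (s : Fin n) (N : ℕ) (l : List (Fin n)) (t : Fin n → ℕ∞) :
    Prop where
  nodup : l.Nodup
  ne_top : ∀ u ∈ l, t u ≠ ⊤
  sorted : l.Pairwise fun u v => t u ≤ t v
  visited_le : ∀ u ∈ l, ∀ v, v ∉ l → t u ≤ t v
  walk : ∀ (v : Fin n) (x : ℕ), t v = x → ∃ ℓ, G.IsWalk s v ℓ ∧ ℓ ≤ 4 * (x : ℝ≥0)
  source : t s = 0
  edge : ∀ u ∈ l, ∀ v ∈ G.adj u, t v ≤ t u + (⌊G.weight u v⌋₊ : ℕ∞)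
  bound : ∀ (v : Fin n) (x : ℕ), t v = x → x ≤ l.length * N

theorem PartialRun.facts {s : Fin n} {N : ℕ} (hw : ∀ u, ∀ v ∈ G.adj u, 1 ≤ G.weight u v)
    (hN : ∀ u, ∀ v ∈ G.adj u, ⌊G.weight u v⌋₊ ≤ N) {l : List (Fin n)} {t : Fin n → ℕ∞}
    (h : PartialRun G s l t) : RunFacts G s N l t := by
  induction h with
  | start =>
    refine ⟨by simp, by simp, by simp, by simp, fun v x hx => ?_, by simp, by simp,
      fun v x hx => ?_⟩
    · split_ifs at hx with h
      · exact ⟨0, h ▸ .nil _, by simp⟩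
      · simp at hx
    · split_ifs at hx with h
      · have : x = 0 := by exact_mod_cast hx.symm
        simp [this]
      · simp at hx
  | @visit l t u _ hul hut hmin ih =>
    -- Visited labels are at most `t u`, hence frozen; this carries most of the facts over to the
    -- new labels.
    have hvis : ∀ v ∈ l ++ [u], relax G t u v = t v := by
      intro v hv
      rw [List.mem_append, List.mem_singleton] at hv
      apply relax_eq hw hut
      rcases hv with hv | rfl
      · exact ih.visited_le v hv u hul
      · exact le_rfl
    obtain ⟨c, hc⟩ := ENat.ne_top_iff_exists.mp hut
    have hlen : (l ++ [u]).length = l.length + 1 := by simp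
    refine ⟨?_, ?_, ?_, ?_, ?_, ?_, ?_, ?_⟩
    · rw [List.nodup_append]
      refine ⟨ih.nodup, by simp, ?_⟩
      intro a ha b hb
      rw [List.mem_singleton] at hb
      rintro rfl
      exact hul (hb ▸ ha)
    · intro v hv
      rw [hvis v hv]
      rw [List.mem_append, List.mem_singleton] at hv
      rcases hv with hv | rfl
      · exact ih.ne_top v hv
      · exact hut
    · have : (l ++ [u]).Pairwise fun u v => t u ≤ t v := by
        rw [List.pairwise_append]
        refine ⟨ih.sorted, by simp, fun a ha b hb => ?_⟩
        rw [List.mem_singleton] at hb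
        exact ih.visited_le a ha b (hb ▸ hul)
      refine this.imp_of_mem fun ha hb h => ?_
      rwa [hvis _ ha, hvis _ hb]
    · intro a ha v hv
      rw [hvis a ha]
      have hv' : v ∉ l := fun h => hv (List.mem_append_left _ h)
      refine le_trans ?_ (le_relax hw hut (hmin v hv'))
      rw [List.mem_append, List.mem_singleton] at ha
      rcases ha with ha | rfl
      · exact ih.visited_le a ha u hul
      · exact le_rfl
    · intro v x hx
      unfold relax at hx
      split_ifs at hx with hv
      · rcases min_choice (t v) (insertBucket (t u).toNat (G.weight u v) : ℕ∞) with h | h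
        · exact ih.walk v x (h ▸ hx)
        -- The new label comes from the edge, so the walk witnessing the label of `u` is prolonged
        -- by this edge.
        · obtain ⟨ℓ, h1, h2⟩ := ih.walk u c hc.symm
          refine ⟨_, h1.snoc hv, ?_⟩
          rw [h, ← hc, ENat.toNat_natCast] at hx
          rw [← ENat.natCast_inj.mp hx]
          exact le_trans (by gcongr) (le_insertBucket (hw u v hv))
      · exact ih.walk v x hx
    · refine le_antisymm ((relax_le t u s).trans ih.source.le) zero_le
    · intro a ha v hv
      rw [hvis a ha]
      rw [List.mem_append, List.mem_singleton] at ha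
      rcases ha with ha | rfl
      · exact (relax_le t u v).trans (ih.edge a ha v hv)
      · unfold relax
        rw [if_pos hv, ← hc, ENat.toNat_natCast]
        refine (min_le_right _ _).trans ?_
        exact_mod_cast insertBucket_le (hw a v hv)
    · intro v x hx
      rw [hlen, add_mul, one_mul]
      unfold relax at hx
      split_ifs at hx with hv
      · rcases min_choice (t v) (insertBucket (t u).toNat (G.weight u v) : ℕ∞) with h | h
        · exact (ih.bound v x (h ▸ hx)).trans (Nat.le_add_right _ _)
        · rw [h, ← hc, ENat.toNat_natCast] at hx
          rw [← ENat.natCast_inj.mp hx]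
          exact (insertBucket_le (hw u v hv)).trans
            (add_le_add (ih.bound u c hc.symm) (hN u v hv))
      · exact (ih.bound v x hx).trans (Nat.le_add_right _ _)

variable {s : Fin n} {N : ℕ} {l : List (Fin n)} {d : Fin n → ℕ∞}

/-- Induction along the walk. A visited vertex has relaxed its edges; an unvisited one has label `⊤`
because the run is complete, and then nothing is to be shown. -/
theorem CompleteRun.le_add_of_isWalk (h : CompleteRun G s l d) (hf : RunFacts G s N l d)
    {u v : Fin n} {ℓ : ℝ≥0} (hp : G.IsWalk u v ℓ) :
    (d v : ℝ≥0∞) ≤ (d u : ℝ≥0∞) + (ℓ : ℝ≥0∞) := by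
  induction hp with
  | nil u => simp
  | @cons u v x ℓ hv _ ih =>
    by_cases hu : u ∈ l
    · have h1 : (d v : ℝ≥0∞) ≤ (d u : ℝ≥0∞) + ((⌊G.weight u v⌋₊ : ℕ) : ℝ≥0∞) := by
        have := ENat.toENNReal_le.mpr (hf.edge u hu v hv)
        simpa using this
      have h2 : ((⌊G.weight u v⌋₊ : ℕ) : ℝ≥0∞) ≤ (G.weight u v : ℝ≥0∞) := by
        have := Nat.floor_le (zero_le (a := G.weight u v))
        exact_mod_cast this
      calc (d x : ℝ≥0∞) ≤ (d v : ℝ≥0∞) + ℓ := ih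
        _ ≤ ((d u : ℝ≥0∞) + (G.weight u v : ℝ≥0∞)) + ℓ := by
            gcongr
            exact h1.trans (by gcongr)
        _ = _ := by push_cast; rw [add_assoc]
    · rw [h.2 u hu]
      simp

theorem CompleteRun.le_add_dist (h : CompleteRun G s l d) (hf : RunFacts G s N l d) (u v : Fin n) :
    (d v : ℝ≥0∞) ≤ (d u : ℝ≥0∞) + G.dist u v := by
  unfold WDigraph.dist
  rcases eq_or_ne (d u) ⊤ with hu | hu
  · simp [hu]
  · simp only [ENNReal.add_iInf]
    rw [le_iInf_iff]
    intro ℓ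
    by_cases hp : G.IsWalk u v ℓ
    · simpa [hp] using h.le_add_of_isWalk hf hp
    · simp [hp]

theorem CompleteRun.le_dist (h : CompleteRun G s l d) (hf : RunFacts G s N l d) (u : Fin n) :
    (d u : ℝ≥0∞) ≤ G.dist s u := by
  have := h.le_add_dist hf s u
  rwa [hf.source, ENat.toENNReal_zero, zero_add] at this

theorem RunFacts.dist_le (hf : RunFacts G s N l d) (u : Fin n) :
    G.dist s u ≤ 4 * (d u : ℝ≥0∞) := by
  rcases eq_or_ne (d u) ⊤ with hu | hu
  · simp [hu]
  · obtain ⟨x, hx⟩ := ENat.ne_top_iff_exists.mp hu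
    obtain ⟨ℓ, h1, h2⟩ := hf.walk u x hx.symm
    refine (iInf₂_le ℓ h1).trans ?_
    rw [← hx]
    have : (ℓ : ℝ≥0∞) ≤ ((4 * (x : ℝ≥0) : ℝ≥0) : ℝ≥0∞) := by exact_mod_cast h2
    simpa using this

theorem CompleteRun.distancePreserving (h : CompleteRun G s l d) (hf : RunFacts G s N l d) :
    G.DistancePreserving (1 / 4) s (fun v => (d v : ℝ≥0∞)) := by
  refine ⟨?_, fun u => ⟨?_, h.le_dist hf u⟩, fun u v => h.le_add_dist hf u v⟩
  · rw [one_div, ENNReal.inv_le_one]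
    norm_num
  · rw [one_div, ENNReal.inv_mul_le_iff (by norm_num) (by norm_num)]
    exact hf.dist_le u

theorem CompleteRun.mem_iff (h : CompleteRun G s l d) (hf : RunFacts G s N l d) (v : Fin n) :
    v ∈ l ↔ G.dist s v ≠ ⊤ := by
  constructor
  · intro hv
    refine ((hf.dist_le v).trans_lt (ENNReal.mul_lt_top (by norm_num) ?_)).ne
    simpa using lt_top_iff_ne_top.mpr (hf.ne_top v hv)
  · intro hd
    by_contra hv
    have := h.le_dist hf v
    rw [h.2 v hv] at this
    exact hd (by simpa using this)

end Runs

/-! ### The layout of the input -/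

section Input

variable {n : ℕ} (G : WDigraph n)

theorem getElem?_flatMap_sum {α β : Type*} (f : α → List β) (L : List α) (i : ℕ) (hi : i < L.length)
    (k : ℕ) (hk : k < (f L[i]).length) :
    (L.flatMap f)[((L.take i).map fun x => (f x).length).sum + k]? = some (f L[i])[k] := by
  induction L generalizing i with
  | nil => simp at hi
  | cons x L ih =>
    cases i with
    | zero =>
      simp only [List.getElem_cons_zero] at hk
      simp [List.getElem?_append_left hk, List.getElem?_eq_getElem hk]
    | succ i =>
      simp only [List.length_cons, Nat.add_lt_add_iff_right] at hi
      simp only [List.getElem_cons_succ] at hk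
      rw [List.flatMap_cons, List.take_succ_cons, List.map_cons, List.sum_cons, add_assoc,
        List.getElem?_append_right (Nat.le_add_right _ _), Nat.add_sub_cancel_left, ih i hi hk]
      rfl

theorem WDigraph.degree_eq : G.degree = fun u => (G.adj u).length := rfl

theorem WDigraph.edges_getElem? (u : Fin n) (k : ℕ) (hk : k < (G.adj u).length) :
    G.edges[G.offset u + k]? = some (u, (G.adj u)[k]) := by
  have := getElem?_flatMap_sum (fun u => (G.adj u).map fun v => (u, v)) (List.finRange n) u
    (by simp) k (by simpa using hk)
  simpa [WDigraph.edges, WDigraph.offset, G.degree_eq] using this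

theorem WDigraph.offset_succ (u : Fin n) : G.offset (u + 1) = G.offset u + G.degree u := by
  unfold WDigraph.offset
  rw [List.take_add_one]
  simp

theorem WDigraph.offset_card : G.offset n = G.edges.length := by
  simp [WDigraph.offset, WDigraph.edges, G.degree_eq, List.length_flatMap, List.take_of_length_le]

theorem WDigraph.length_edges_eq_sum : G.edges.length = ∑ u, G.degree u := by
  simp [WDigraph.edges, WDigraph.degree, List.length_flatMap, ← Fin.sum_univ_def]

theorem WDigraph.length_edges_le : G.edges.length ≤ n * n := by
  rw [G.length_edges_eq_sum]
  calc ∑ u, G.degree u ≤ ∑ _u : Fin n, n := Finset.sum_le_sum fun u _ => by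
        simpa [G.degree_eq] using (G.nodup u).length_le_card
    _ = n * n := by simp

theorem WDigraph.sum_degree_le {l : List (Fin n)} (hl : l.Nodup) :
    (l.map G.degree).sum ≤ G.edges.length := by
  rw [G.length_edges_eq_sum, ← List.sum_toFinset _ hl]
  exact Finset.sum_le_sum_of_subset (Finset.subset_univ _)

theorem WDigraph.sum_take_degree_le (l : List (Fin n)) (i : ℕ) :
    ((l.take i).map G.degree).sum ≤ (l.map G.degree).sum := by
  conv_rhs => rw [← List.take_append_drop i l, List.map_append, List.sum_append]
  exact Nat.le_add_right _ _

theorem WDigraph.inputMem_zero (s : Fin n) : G.inputMem s 0 = n := by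
  simp [WDigraph.inputMem]

theorem WDigraph.inputMem_one (s : Fin n) : G.inputMem s 1 = s := by
  simp [WDigraph.inputMem]

theorem WDigraph.inputMem_offset (s : Fin n) {i : ℕ} (hi : i ≤ n) :
    G.inputMem s (i + 2) = G.offset i := by
  have : i < n + 1 := by omega
  simp [WDigraph.inputMem, List.getElem?_append_left, this]

theorem WDigraph.inputMem_head (s u : Fin n) (k : ℕ) (hk : k < (G.adj u).length) :
    G.inputMem s (n + 3 + (G.offset u + k)) = ((G.adj u)[k] : ℕ) := by
  unfold WDigraph.inputMem
  rw [List.getD_eq_getElem?_getD, List.getElem?_append_right (by simp)]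
  simp only [List.length_append, List.length_cons, List.length_nil, List.length_map,
    List.length_range, List.getElem?_map]
  rw [show n + 3 + (G.offset u + k) - (0 + 1 + 1 + (n + 1)) = G.offset u + k by omega,
    G.edges_getElem? u k hk]
  rfl

theorem WDigraph.inputMem_of_le (s : Fin n) {i : ℕ} (hi : n + 3 + G.edges.length ≤ i) :
    G.inputMem s i = 0 := by
  unfold WDigraph.inputMem
  rw [List.getD_eq_getElem?_getD, List.getElem?_eq_none (by simp; omega)]
  rfl

theorem WDigraph.inputWeights_eq (u : Fin n) (k : ℕ) (hk : k < (G.adj u).length) :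
    G.inputWeights (G.offset u + k) = G.weight u (G.adj u)[k] := by
  unfold WDigraph.inputWeights
  rw [List.getD_eq_getElem?_getD, List.getElem?_map, G.edges_getElem? u k hk]
  rfl

end Input

/-! ### The queue -/

section Queue

variable {V : Type*}

/-- The queue of the algorithm: `cur` lists what is left in the current bucket, whose shifted label
is `a`, and `L j` lists the content of the frontier bucket of level `j + 1`, whose shifted label is
`lab j`.  A vertex is not removed from a bucket when it is inserted into another one.  The visited
vertices are those of `l`, and `t` are the labels of the run. -/
structure QueueInv (l : List V) (t : V → ℕ∞) (a : ℕ) (cur : List V) (L : ℕ → List V)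
    (lab : ℕ → ℕ) (B : ℕ) : Prop where
  frontier : ∀ j, L j ≠ [] → FrontierAt a j (lab j)
  lab_le : ∀ j, L j ≠ [] → lab j ≤ B
  le_bound : a ≤ B
  live : ∀ v, v ∉ l → t v ≠ ⊤ → (v ∈ cur ∧ t v + 1 = a) ∨ ∃ j, v ∈ L j ∧ t v + 1 = lab j
  cur_le : ∀ v ∈ cur, t v + 1 ≤ a
  le_lab : ∀ j, ∀ v ∈ L j, t v + 1 ≤ lab j

namespace QueueInv

variable {l : List V} {t t' : V → ℕ∞} {a : ℕ} {cur : List V} {L : ℕ → List V} {lab : ℕ → ℕ}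
  {B : ℕ}

/-- The entry is added whether or not the label of `y` decreases. If it does, the older entries of
`y` become stale; if not, the new entry may itself be superfluous. Either way the label of an
entry's bucket bounds the vertex's label from above, which is all that is required of stale entries.
-/
theorem push (h : QueueInv l t a cur L lab B) {j b : ℕ} {y : V} (hb : FrontierAt a j (b + 1))
    (hB : b + 1 ≤ B) (hy : t' y = min (t y) (b : ℕ∞)) (hv : ∀ v, v ≠ y → t' v = t v) :
    QueueInv l t' a cur (Function.update L j (y :: L j)) (Function.update lab j (b + 1)) B := by
  have hle : ∀ v, t' v + 1 ≤ t v + 1 := by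
    intro v
    gcongr
    by_cases hvy : v = y
    · rw [hvy, hy]
      exact min_le_left _ _
    · rw [hv v hvy]
  have hyb : t' y + 1 ≤ ((b + 1 : ℕ) : ℕ∞) := by
    rw [hy]
    push_cast
    gcongr
    exact min_le_right _ _
  -- A non-empty list of this level already has the right label, by uniqueness of the frontier
  -- bucket, so overwriting `lab j` is harmless.
  have hj : ∀ v ∈ L j, lab j = b + 1 := fun v hvj =>
    (h.frontier j (List.ne_nil_of_mem hvj)).unique hb
  refine ⟨fun i hi => ?_, fun i hi => ?_, h.le_bound, fun v hvl hvt => ?_, fun v hvc => ?_,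
    fun i v hvi => ?_⟩
  · rcases eq_or_ne i j with rfl | hij
    · simpa using hb
    · rw [Function.update_of_ne hij] at hi ⊢
      exact h.frontier i hi
  · rcases eq_or_ne i j with rfl | hij
    · simpa using hB
    · rw [Function.update_of_ne hij] at hi ⊢
      exact h.lab_le i hi
  · by_cases hnew : v = y ∧ t' y = (b : ℕ∞)
    · obtain ⟨rfl, hnew⟩ := hnew
      refine Or.inr ⟨j, by simp, ?_⟩
      rw [hnew]
      simp
    · have hsame : t' v = t v := by
        by_cases hvy : v = y
        · subst hvy
          rcases min_choice (t v) (b : ℕ∞) with hm | hm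
          · rw [hy, hm]
          · exact absurd ⟨rfl, hy.trans hm⟩ hnew
        · exact hv v hvy
      rw [hsame] at hvt ⊢
      rcases h.live v hvl hvt with hc | ⟨i, hi, hi'⟩
      · exact Or.inl hc
      · refine Or.inr ⟨i, ?_⟩
        rcases eq_or_ne i j with rfl | hij
        · refine ⟨by simp [hi], ?_⟩
          rw [hi', hj v hi]
          simp
        · simpa [Function.update_of_ne hij] using ⟨hi, hi'⟩
  · exact (hle v).trans (h.cur_le v hvc)
  · rcases eq_or_ne i j with rfl | hij
    · rw [Function.update_self] at hvi ⊢
      rcases List.mem_cons.mp hvi with rfl | hvi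
      · exact hyb
      · rw [← hj v hvi]
        exact (hle v).trans (h.le_lab i v hvi)
    · rw [Function.update_of_ne hij] at hvi ⊢
      exact (hle v).trans (h.le_lab i v hvi)

theorem pop_visited {v : V} (h : QueueInv l t a (v :: cur) L lab B) (hv : v ∈ l) :
    QueueInv l t a cur L lab B := by
  refine ⟨h.frontier, h.lab_le, h.le_bound, fun x hx hxt => ?_,
    fun x hx => h.cur_le x (List.mem_cons_of_mem _ hx), h.le_lab⟩
  rcases h.live x hx hxt with ⟨h1, h2⟩ | h1
  · rcases List.mem_cons.mp h1 with rfl | h1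
    · exact absurd hv hx
    · exact Or.inl ⟨h1, h2⟩
  · exact Or.inr h1

theorem visit {v : V} (h : QueueInv l t a (v :: cur) L lab B) :
    QueueInv (l ++ [v]) t a (v :: cur) L lab B :=
  ⟨h.frontier, h.lab_le, h.le_bound,
    fun x hx hxt => h.live x (fun hxl => hx (List.mem_append_left _ hxl)) hxt, h.cur_le, h.le_lab⟩

/-- The live entry of an unvisited vertex lies in the current bucket or in a frontier bucket, and
the latter has a larger label. -/
theorem le_add_one (h : QueueInv l t a cur L lab B) {v : V} (hv : v ∉ l) : (a : ℕ∞) ≤ t v + 1 := by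
  rcases eq_or_ne (t v) ⊤ with ht | ht
  · simp [ht]
  · rcases h.live v hv ht with ⟨-, h1⟩ | ⟨j, h1, h2⟩
    · exact h1.ge
    · rw [h2]
      exact_mod_cast (h.frontier j (List.ne_nil_of_mem h1)).2.1.le

/-- A stale entry would only give an upper bound for the label, but an unvisited vertex cannot have
a label below the current one. So the label can be read off the current bucket. -/
theorem head_eq {v : V} (h : QueueInv l t a (v :: cur) L lab B) (hv : v ∉ l) : t v + 1 = a :=
  le_antisymm (h.cur_le v (by simp)) (h.le_add_one hv)

theorem head_le {v x : V} (h : QueueInv l t a (v :: cur) L lab B) (hv : v ∉ l) (hx : x ∉ l) :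
    t v ≤ t x := by
  have h1 := h.le_add_one hx
  rw [← h.head_eq hv] at h1
  exact (ENat.add_le_add_iff_right ENat.one_ne_top).mp h1

/-- The new current label is strictly below the other non-empty buckets, since different levels have
different labels; so they remain frontier buckets. -/
theorem advance (h : QueueInv l t a [] L lab B) {j : ℕ} (hj : L j ≠ [])
    (hmin : ∀ i, L i ≠ [] → lab j ≤ lab i) :
    QueueInv l t (lab j) (L j) (Function.update L j []) lab B := by
  have hfj := h.frontier j hj
  refine ⟨fun i hi => ?_, fun i hi => ?_, h.lab_le j hj, fun v hvl hvt => ?_, h.le_lab j,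
    fun i v hvi => ?_⟩
  · rcases eq_or_ne i j with rfl | hij
    · simp at hi
    · rw [Function.update_of_ne hij] at hi
      have hfi := h.frontier i hi
      refine hfi.mono hfj.2.1.le (lt_of_le_of_ne (hmin i hi) fun heq => hij ?_)
      rw [← heq] at hfi
      exact hfi.level_unique hfj
  · rcases eq_or_ne i j with rfl | hij
    · simp at hi
    · rw [Function.update_of_ne hij] at hi
      exact h.lab_le i hi
  · rcases h.live v hvl hvt with ⟨h1, -⟩ | ⟨i, h1, h2⟩
    · simp at h1
    · rcases eq_or_ne i j with rfl | hij
      · exact Or.inl ⟨h1, h2⟩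
      · exact Or.inr ⟨i, by rwa [Function.update_of_ne hij], h2⟩
  · rcases eq_or_ne i j with rfl | hij
    · simp at hvi
    · rw [Function.update_of_ne hij] at hvi
      exact h.le_lab i v hvi

theorem eq_top_of_empty (h : QueueInv l t a [] L lab B) (hL : ∀ j, L j = []) {v : V} (hv : v ∉ l) :
    t v = ⊤ := by
  by_contra ht
  rcases h.live v hv ht with ⟨h1, -⟩ | ⟨i, h1, -⟩
  · simp at h1
  · simp [hL] at h1

end QueueInv

/-! ### Finding the non-empty frontier bucket of smallest label -/

theorem testBit_padicValNat {x : ℕ} (hx : x ≠ 0) : x.testBit (padicValNat 2 x) = true := by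
  have h := padicValNat_two_eq_iff.mp ⟨rfl, hx⟩
  set i := padicValNat 2 x
  rw [Nat.testBit_eq_decide_div_mod_eq, decide_eq_true_eq, Nat.mod_pow_succ] at *
  have h0 : x % 2 ^ i < 2 ^ i := Nat.mod_lt _ (by positivity)
  rcases Nat.mod_two_eq_zero_or_one (x / 2 ^ i) with h1 | h1
  · rw [h1] at h
    omega
  · exact h1

theorem padicValNat_le_of_testBit {x j : ℕ} (h : x.testBit j = true) : padicValNat 2 x ≤ j := by
  obtain ⟨q, hq⟩ := @pow_padicValNat_dvd 2 x
  rw [hq, Nat.testBit_two_pow_mul] at h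
  simp only [Bool.and_eq_true, decide_eq_true_eq] at h
  exact h.1

/-- The next multiple of `2 ^ i` after `a`. -/
def nextMultiple (a i : ℕ) : ℕ := (a / 2 ^ i + 1) * 2 ^ i

theorem lt_nextMultiple (a i : ℕ) : a < nextMultiple a i := by
  have h1 := Nat.div_add_mod a (2 ^ i)
  have h2 := Nat.mod_lt a (show 0 < 2 ^ i by positivity)
  unfold nextMultiple
  nlinarith

theorem nextMultiple_le_add (a i : ℕ) : nextMultiple a i ≤ a + 2 ^ i := by
  have h1 := Nat.div_mul_le_self a (2 ^ i)
  unfold nextMultiple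
  rw [add_mul]
  omega

theorem nextMultiple_le {a i b : ℕ} (hb : 2 ^ i ∣ b) (hab : a < b) : nextMultiple a i ≤ b := by
  obtain ⟨z, rfl⟩ := hb
  unfold nextMultiple
  rw [mul_comm (2 ^ i) z]
  gcongr
  rw [Nat.add_one_le_iff, Nat.div_lt_iff_lt_mul (by positivity), mul_comm z]
  exact hab

section Min

variable {L : ℕ → List V} {lab : ℕ → ℕ} {a M : ℕ}

/-- With `i` the lowest non-empty level index, all labels in use are multiples of `2 ^ i` beyond
`a`, so none precedes the next multiple. If the level of that multiple is in use, its frontier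
bucket is this multiple itself. -/
theorem lab_eq_nextMultiple (hf : ∀ j, L j ≠ [] → FrontierAt a j (lab j))
    (hM : ∀ j, M.testBit j = true ↔ L j ≠ [])
    (h : M.testBit (padicValNat 2 (nextMultiple a (padicValNat 2 M))) = true) :
    lab (padicValNat 2 (nextMultiple a (padicValNat 2 M))) = nextMultiple a (padicValNat 2 M) ∧
      ∀ j, L j ≠ [] → nextMultiple a (padicValNat 2 M) ≤ lab j := by
  set i := padicValNat 2 M
  have hN := lt_nextMultiple a i
  refine ⟨(hf _ ((hM _).mp h)).unique ⟨padicValNat_two_eq_iff.mp ⟨rfl, by omega⟩, hN, ?_⟩, ?_⟩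
  · refine (nextMultiple_le_add a i).trans ?_
    gcongr
    · norm_num
    · exact (padicValNat_le_of_testBit h).trans (Nat.le_succ _)
  · intro j hj
    refine nextMultiple_le ?_ (hf j hj).2.1
    exact (pow_dvd_pow 2 (padicValNat_le_of_testBit ((hM j).mpr hj))).trans (hf j hj).pow_dvd

/-- Now the next multiple is not a bucket in use, so every label is at least one multiple further.
Level `i + 1` is in use, hence the next multiple is not on it and has a higher valuation; adding `2
^ i` to it gives valuation exactly `i`. -/
theorem lab_eq_nextMultiple_add (hf : ∀ j, L j ≠ [] → FrontierAt a j (lab j))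
    (hM : ∀ j, M.testBit j = true ↔ L j ≠ []) (hM0 : M ≠ 0)
    (h : ¬ M.testBit (padicValNat 2 (nextMultiple a (padicValNat 2 M))) = true) :
    lab (padicValNat 2 M) = nextMultiple a (padicValNat 2 M) + 2 ^ padicValNat 2 M ∧
      ∀ j, L j ≠ [] → nextMultiple a (padicValNat 2 M) + 2 ^ padicValNat 2 M ≤ lab j := by
  have hi := testBit_padicValNat hM0
  have hdvd : ∀ j, L j ≠ [] → 2 ^ padicValNat 2 M ∣ lab j := fun j hj =>
    (pow_dvd_pow 2 (padicValNat_le_of_testBit ((hM j).mpr hj))).trans (hf j hj).pow_dvd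
  set i := padicValNat 2 M with hidef
  have hN := lt_nextMultiple a i
  have hN' := nextMultiple_le_add a i
  have hpos : 0 < 2 ^ i := by positivity
  have hm : i + 1 ≤ padicValNat 2 (nextMultiple a i) := by
    have h1 : i ≤ padicValNat 2 (nextMultiple a i) :=
      (padicValNat_dvd_iff_le (by omega)).mp (Dvd.intro_left _ rfl)
    rcases h1.eq_or_lt with h2 | h2
    · rw [← h2] at h
      exact absurd hi h
    · exact h2
  have hdm : 2 ^ (i + 1) ∣ nextMultiple a i := (padicValNat_dvd_iff_le (by omega)).mpr hm
  have hpow : 2 ^ (i + 1) = 2 ^ i + 2 ^ i := by rw [pow_succ]; ring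
  refine ⟨(hf _ ((hM _).mp hi)).unique ⟨?_, by omega, by omega⟩, ?_⟩
  · rw [Nat.add_mod, Nat.mod_eq_zero_of_dvd hdm, zero_add, Nat.mod_mod, Nat.mod_eq_of_lt (by omega)]
  · intro j hj
    have h1 := nextMultiple_le (hdvd j hj) (hf j hj).2.1
    have h2 : nextMultiple a i ≠ lab j := by
      intro heq
      have h3 := (padicValNat_two_eq_iff.mpr (hf j hj).1).1
      rw [← heq] at h3
      rw [h3] at h
      exact h ((hM j).mpr hj)
    have h3 := Nat.dvd_sub (hdvd j hj) (show 2 ^ i ∣ nextMultiple a i from Dvd.intro_left _ rfl)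
    have := Nat.le_of_dvd (by omega) h3
    omega

end Min

end Queue

/-! ### Reasoning about programs -/

section Wp

/-- The program `p`, started in `σ`, terminates in a configuration that satisfies `Q`. -/
def Wp (w : ℕ) (W : ℕ → ℝ≥0) (p : Program) (Q : Config → Prop) (σ : Config) : Prop :=
  ∃ τ, Exec w W p σ τ ∧ Q τ

infixr:60 " ⨾ " => Program.seq

@[simp] theorem Config.setReg_reg (σ : Config) (d v : ℕ) :
    (σ.setReg d v).reg = Function.update σ.reg d v := rfl
@[simp] theorem Config.setReg_mem (σ : Config) (d v : ℕ) : (σ.setReg d v).mem = σ.mem := rfl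
@[simp] theorem Config.setReg_time (σ : Config) (d v : ℕ) :
    (σ.setReg d v).time = σ.time + 1 := rfl
@[simp] theorem Config.setReg_out (σ : Config) (d v : ℕ) : (σ.setReg d v).out = σ.out := rfl
@[simp] theorem Config.setMem_reg (σ : Config) (d v : ℕ) : (σ.setMem d v).reg = σ.reg := rfl
@[simp] theorem Config.setMem_mem (σ : Config) (d v : ℕ) :
    (σ.setMem d v).mem = Function.update σ.mem d v := rfl
@[simp] theorem Config.setMem_time (σ : Config) (d v : ℕ) :
    (σ.setMem d v).time = σ.time + 1 := rfl
@[simp] theorem Config.setMem_out (σ : Config) (d v : ℕ) : (σ.setMem d v).out = σ.out := rfl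
@[simp] theorem Config.emit_reg (σ : Config) (x y : ℕ) : (σ.emit x y).reg = σ.reg := rfl
@[simp] theorem Config.emit_mem (σ : Config) (x y : ℕ) : (σ.emit x y).mem = σ.mem := rfl
@[simp] theorem Config.emit_time (σ : Config) (x y : ℕ) : (σ.emit x y).time = σ.time + 1 := rfl
@[simp] theorem Config.emit_out (σ : Config) (x y : ℕ) :
    (σ.emit x y).out = σ.out ++ [(σ.time + 1, x, y)] := rfl
@[simp] theorem Config.tick_reg (σ : Config) : σ.tick.reg = σ.reg := rfl
@[simp] theorem Config.tick_mem (σ : Config) : σ.tick.mem = σ.mem := rfl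
@[simp] theorem Config.tick_time (σ : Config) : σ.tick.time = σ.time + 1 := rfl
@[simp] theorem Config.tick_out (σ : Config) : σ.tick.out = σ.out := rfl

variable {w : ℕ} {W : ℕ → ℝ≥0} {p q : Program} {Q R : Config → Prop} {σ : Config} {d a b : ℕ}

theorem Wp.mono (h : Wp w W p Q σ) (hQ : ∀ τ, Q τ → R τ) : Wp w W p R σ :=
  let ⟨τ, h1, h2⟩ := h
  ⟨τ, h1, hQ τ h2⟩

theorem wp_seq (h : Wp w W p (Wp w W q Q) σ) : Wp w W (p ⨾ q) Q σ :=
  let ⟨_, h1, υ, h2, h3⟩ := h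
  ⟨υ, .seq h1 h2, h3⟩

theorem wp_skip (h : Q σ.tick) : Wp w W .skip Q σ := ⟨_, .skip, h⟩

theorem wp_const (v : ℕ) (hv : v < 2 ^ w) (h : Wp w W q Q (σ.setReg d v)) :
    Wp w W (.const d v ⨾ q) Q σ := wp_seq ⟨_, .const hv, h⟩

theorem wp_op (x : ℕ) {o : BinOp} (hx : o.eval (σ.reg a) (σ.reg b) = x) (hw : x < 2 ^ w)
    (h : Wp w W q Q (σ.setReg d x)) : Wp w W (.op o d a b ⨾ q) Q σ := by
  subst hx
  exact wp_seq ⟨_, .op hw, h⟩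

theorem wp_log (x : ℕ) (hx : Nat.log 2 (σ.reg a) = x) (hw : x < 2 ^ w)
    (h : Wp w W q Q (σ.setReg d x)) : Wp w W (.log d a ⨾ q) Q σ := by
  subst hx
  exact wp_seq ⟨_, .log hw, h⟩

theorem wp_floor (x : ℕ) (hx : ⌊W (σ.reg a)⌋₊ = x) (hw : x < 2 ^ w)
    (h : Wp w W q Q (σ.setReg d x)) : Wp w W (.floor d a ⨾ q) Q σ := by
  subst hx
  exact wp_seq ⟨_, .floor hw, h⟩

theorem wp_load (x : ℕ) (hx : σ.mem (σ.reg a) = x) (hw : x < 2 ^ w)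
    (h : Wp w W q Q (σ.setReg d x)) : Wp w W (.load d a ⨾ q) Q σ := by
  subst hx
  exact wp_seq ⟨_, .load hw, h⟩

theorem wp_store (i x : ℕ) (hi : σ.reg a = i) (hx : σ.reg b = x)
    (h : Wp w W q Q (σ.setMem i x)) : Wp w W (.store a b ⨾ q) Q σ := by
  subst hi hx
  exact wp_seq ⟨_, .store, h⟩

theorem wp_output (x y : ℕ) (hx : σ.reg a = x) (hy : σ.reg b = y)
    (h : Wp w W q Q (σ.emit x y)) : Wp w W (.output a b ⨾ q) Q σ := by
  subst hx hy
  exact wp_seq ⟨_, .output, h⟩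

theorem wp_ifLt (h1 : σ.reg a < σ.reg b → Wp w W p Q σ.tick)
    (h2 : ¬ σ.reg a < σ.reg b → Wp w W q Q σ.tick) : Wp w W (.ifLt a b p q) Q σ := by
  by_cases h : σ.reg a < σ.reg b
  · obtain ⟨τ, h3, h4⟩ := h1 h
    exact ⟨τ, .ifTrue h h3, h4⟩
  · obtain ⟨τ, h3, h4⟩ := h2 h
    exact ⟨τ, .ifFalse h h3, h4⟩

/-- Total correctness of a loop with the invariant `I`, whose first argument decreases. -/
theorem wp_while (I : ℕ → Config → Prop)
    (hstep : ∀ N σ, I N σ → σ.reg a < σ.reg b →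
      Wp w W p (fun τ => ∃ N' < N, I N' τ) σ.tick)
    (hend : ∀ N σ, I N σ → ¬ σ.reg a < σ.reg b → Q σ.tick) {N : ℕ} (hI : I N σ) :
    Wp w W (.whileLt a b p) Q σ := by
  induction N using Nat.strong_induction_on generalizing σ with
  | _ N ih =>
    by_cases h : σ.reg a < σ.reg b
    · obtain ⟨τ, h1, N', hN', h2⟩ := hstep N σ hI h
      obtain ⟨υ, h3, h4⟩ := ih N' hN' h2
      exact ⟨υ, .whileTrue h h1 h3, h4⟩
    · exact ⟨_, .whileFalse h, hend N σ hI h⟩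

end Wp

/-! ### The memory -/

section Memory

/-- The memory: the input, in the cells below `Z`, and four interleaved arrays. -/
def layout (inp : ℕ → ℕ) (Z : ℕ) (f₀ f₁ f₂ f₃ : ℕ → ℕ) : ℕ → ℕ := fun x =>
  if x < Z then inp x
  else if (x - Z) % 4 = 0 then f₀ ((x - Z) / 4)
  else if (x - Z) % 4 = 1 then f₁ ((x - Z) / 4)
  else if (x - Z) % 4 = 2 then f₂ ((x - Z) / 4)
  else f₃ ((x - Z) / 4)

variable (inp : ℕ → ℕ) (Z : ℕ) (f₀ f₁ f₂ f₃ : ℕ → ℕ) (i x : ℕ)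

theorem layout_input (h : i < Z) : layout inp Z f₀ f₁ f₂ f₃ i = inp i := if_pos h

theorem layout_zero : layout inp Z f₀ f₁ f₂ f₃ (4 * i + Z) = f₀ i := by
  simp [layout]

theorem layout_one : layout inp Z f₀ f₁ f₂ f₃ (4 * i + (Z + 1)) = f₁ i := by
  unfold layout
  rw [if_neg (by omega), if_neg (by omega), if_pos (by omega)]
  congr 1; omega

theorem layout_two : layout inp Z f₀ f₁ f₂ f₃ (4 * i + (Z + 2)) = f₂ i := by
  unfold layout
  rw [if_neg (by omega), if_neg (by omega), if_neg (by omega), if_pos (by omega)]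
  congr 1; omega

theorem layout_three : layout inp Z f₀ f₁ f₂ f₃ (4 * i + (Z + 3)) = f₃ i := by
  unfold layout
  rw [if_neg (by omega), if_neg (by omega), if_neg (by omega), if_neg (by omega)]
  congr 1; omega

theorem update_layout_zero : Function.update (layout inp Z f₀ f₁ f₂ f₃) (4 * i + Z) x =
    layout inp Z (Function.update f₀ i x) f₁ f₂ f₃ := by
  funext y
  simp only [Function.update_apply, layout]
  split_ifs <;> first | rfl | omega

theorem update_layout_one : Function.update (layout inp Z f₀ f₁ f₂ f₃) (4 * i + (Z + 1)) x =
    layout inp Z f₀ (Function.update f₁ i x) f₂ f₃ := by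
  funext y
  simp only [Function.update_apply, layout]
  split_ifs <;> first | rfl | omega

theorem update_layout_two : Function.update (layout inp Z f₀ f₁ f₂ f₃) (4 * i + (Z + 2)) x =
    layout inp Z f₀ f₁ (Function.update f₂ i x) f₃ := by
  funext y
  simp only [Function.update_apply, layout]
  split_ifs <;> first | rfl | omega

theorem update_layout_three : Function.update (layout inp Z f₀ f₁ f₂ f₃) (4 * i + (Z + 3)) x =
    layout inp Z f₀ f₁ f₂ (Function.update f₃ i x) := by
  funext y
  simp only [Function.update_apply, layout]
  split_ifs <;> first | rfl | omega

theorem eq_layout (h : ∀ i, Z ≤ i → inp i = 0) :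
    inp = layout inp Z (fun _ => 0) (fun _ => 0) (fun _ => 0) (fun _ => 0) := by
  funext y
  unfold layout
  split_ifs with h1
  · rfl
  all_goals exact h y (by omega)

/-- The linked list that starts at the entry `p` spells the list of vertices. Only entries with the
numbers `1, …, cnt` are used. -/
def Chain {n : ℕ} (nxt vert : ℕ → ℕ) (cnt : ℕ) : ℕ → List (Fin n) → Prop
  | p, [] => p = 0
  | p, v :: vs => 0 < p ∧ p ≤ cnt ∧ vert p = v ∧ Chain nxt vert cnt (nxt p) vs

variable {n : ℕ} {nxt vert : ℕ → ℕ} {cnt p : ℕ} {vs : List (Fin n)}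

theorem Chain.le (h : Chain nxt vert cnt p vs) : p ≤ cnt := by
  cases vs with
  | nil => exact h.le.trans (Nat.zero_le _)
  | cons v vs => exact h.2.1

theorem Chain.pos_iff (h : Chain nxt vert cnt p vs) : 0 < p ↔ vs ≠ [] := by
  cases vs with
  | nil => simp [show p = 0 from h]
  | cons v vs => simp [h.1]

/-- No existing list passes through the fresh entry `cnt + 1`. -/
theorem Chain.alloc (h : Chain nxt vert cnt p vs) (x y : ℕ) :
    Chain (Function.update nxt (cnt + 1) x) (Function.update vert (cnt + 1) y) (cnt + 1) p vs := by
  induction vs generalizing p with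
  | nil => exact h
  | cons v vs ih =>
    obtain ⟨h1, h2, h3, h4⟩ := h
    have hp : p ≠ cnt + 1 := by omega
    refine ⟨h1, by omega, by rwa [Function.update_of_ne hp], ?_⟩
    rw [Function.update_of_ne hp]
    exact ih h4

end Memory

/-! ### The program -/

/-- Relaxation of the edge with the number `R[16]`, whose tail has the label `R[15]`. -/
def relaxEdge : Program :=
  .op .add 18 4 16 ⨾ .load 18 18 ⨾
  .floor 19 16 ⨾ .op .add 19 19 1 ⨾ .log 19 19 ⨾ .op .sub 19 19 1 ⨾
  .op .shr 20 15 19 ⨾ .op .add 20 20 2 ⨾ .op .shl 20 20 19 ⨾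
  .op .sub 21 20 1 ⨾ .op .xor 21 20 21 ⨾ .log 21 21 ⨾
  .op .add 12 12 1 ⨾
  .op .mul 22 3 12 ⨾ .op .add 23 22 6 ⨾ .store 23 18 ⨾
  .op .mul 24 3 21 ⨾ .op .add 24 24 8 ⨾ .load 25 24 ⨾
  .op .add 22 22 5 ⨾ .store 22 25 ⨾ .store 24 12 ⨾
  .op .shl 26 1 21 ⨾ .op .lor 11 11 26 ⨾
  .op .add 16 16 1 ⨾ .skip

/-- The visit of the vertex `R[14]`, whose flag is stored in the cell `R[18]`. -/
def visitVertex : Program :=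
  .store 18 1 ⨾ .op .sub 15 9 1 ⨾ .output 14 15 ⨾
  .op .add 18 14 2 ⨾ .load 16 18 ⨾ .op .add 18 18 1 ⨾ .load 17 18 ⨾
  .whileLt 16 17 relaxEdge

/-- Removal of the first vertex from the current bucket; it is visited if this has not been done
before. -/
def popVertex : Program :=
  .op .mul 18 3 10 ⨾ .op .add 19 18 6 ⨾ .load 14 19 ⨾ .op .add 18 18 5 ⨾ .load 10 18 ⨾
  .op .mul 18 3 14 ⨾ .op .add 18 18 7 ⨾ .load 19 18 ⨾
  .ifLt 19 1 visitVertex .skip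

/-- The next bucket: its level is put into `R[14]`, and its shifted label into `R[9]`. -/
def selectBucket : Program :=
  .op .sub 14 11 1 ⨾ .op .xor 14 11 14 ⨾ .log 14 14 ⨾
  .op .shr 15 9 14 ⨾ .op .add 15 15 1 ⨾ .op .shl 15 15 14 ⨾
  .op .sub 16 15 1 ⨾ .op .xor 16 15 16 ⨾ .log 16 16 ⨾
  .op .shl 17 1 16 ⨾ .op .land 18 11 17 ⨾
  .ifLt 0 18
    (.op .add 9 15 0 ⨾ .op .add 14 16 0 ⨾ .skip)
    (.op .shl 17 1 14 ⨾ .op .add 9 15 17 ⨾ .skip)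

/-- The bucket of level `R[14]` becomes the current bucket. -/
def takeBucket : Program :=
  .op .shl 17 1 14 ⨾ .op .xor 11 11 17 ⨾
  .op .mul 18 3 14 ⨾ .op .add 18 18 8 ⨾ .load 10 18 ⨾ .store 18 0 ⨾ .skip

/-- Registers 1 to 3 hold the constants 1, 2, 4; register 4 is the first cell of the edge heads, and
5 to 8 are the bases of the interleaved arrays (links, vertices, visited flags, list heads). The
source becomes entry 1, because 0 is the null pointer. -/
def setup : Program :=
  .const 1 1 ⨾ .const 2 2 ⨾ .const 3 4 ⨾
  .load 14 0 ⨾ .const 15 3 ⨾ .op .add 4 14 15 ⨾ .op .add 15 14 2 ⨾ .load 15 15 ⨾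
  .op .add 5 4 15 ⨾ .op .add 6 5 1 ⨾ .op .add 7 5 2 ⨾ .op .add 8 6 2 ⨾
  .load 14 1 ⨾ .op .add 15 3 6 ⨾ .store 15 14 ⨾
  .const 9 1 ⨾ .const 10 1 ⨾ .const 12 1 ⨾ .const 13 1 ⨾ .skip

/-- Register 13 is the sum of the current list pointer and the mask; it vanishes exactly when the
queue is empty. -/
def loopBody : Program :=
  .ifLt 0 10 .skip (selectBucket ⨾ takeBucket) ⨾ popVertex ⨾ .op .add 13 10 11 ⨾ .skip

def bucketDijkstra : Program := setup ⨾ .whileLt 0 13 loopBody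

/-! ### The relaxation of one edge -/

section Blocks

/-- All numbers that occur are less than a small multiple of `2 ^ J`, and fit into a word. -/
structure Fits (w J n m B : ℕ) : Prop where
  card : n < 2 ^ J
  edges : m < 2 ^ J
  label : B < 2 ^ J
  word : 128 * 2 ^ J ≤ 2 ^ w

/-- The registers and the memory represent the queue. -/
structure Represents {n : ℕ} (G : WDigraph n) (s : Fin n) (l : List (Fin n)) (a cnt : ℕ)
    (cur : List (Fin n)) (L : ℕ → List (Fin n)) (σ : Config) : Prop where
  r0 : σ.reg 0 = 0
  r1 : σ.reg 1 = 1
  r2 : σ.reg 2 = 2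
  r3 : σ.reg 3 = 4
  r4 : σ.reg 4 = n + 3
  r5 : σ.reg 5 = n + 3 + G.edges.length
  r6 : σ.reg 6 = n + 3 + G.edges.length + 1
  r7 : σ.reg 7 = n + 3 + G.edges.length + 2
  r8 : σ.reg 8 = n + 3 + G.edges.length + 3
  r9 : σ.reg 9 = a
  r12 : σ.reg 12 = cnt
  mask : ∀ j, (σ.reg 11).testBit j = true ↔ L j ≠ []
  memory : ∃ nxt vert flag head,
    σ.mem = layout (G.inputMem s) (n + 3 + G.edges.length) nxt vert flag head ∧
    Chain nxt vert cnt (σ.reg 10) cur ∧ (∀ j, Chain nxt vert cnt (head j) (L j)) ∧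
    ∀ v : Fin n, flag v = if v ∈ l then 1 else 0

variable {n : ℕ} {G : WDigraph n} {s : Fin n} {l : List (Fin n)} {a cnt B w J : ℕ}
  {cur : List (Fin n)} {L : ℕ → List (Fin n)} {lab : ℕ → ℕ} {σ : Config} {t : Fin n → ℕ∞}

theorem FrontierAt.lt_of_fits {j b m : ℕ} (hF : Fits w J n m B) (h : FrontierAt a j b)
    (hb : b ≤ B) : j < J :=
  (Nat.pow_lt_pow_iff_right (by norm_num : 1 < 2)).mp ((h.pow_le.trans hb).trans_lt hF.label)

theorem Represents.mask_lt {m : ℕ} (hF : Fits w J n m B) (hR : Represents G s l a cnt cur L σ)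
    (hQ : QueueInv l t a cur L lab B) : σ.reg 11 < 2 ^ J := by
  refine Nat.lt_pow_two_of_testBit _ fun j hj => ?_
  by_contra h
  have hL := (hR.mask j).mp (by simpa using h)
  exact absurd ((hQ.frontier j hL).lt_of_fits hF (hQ.lab_le j hL)) (by omega)

/-- The level of the target bucket is the number of trailing zeros of its shifted label, so no
search over the levels is needed. The label of the head is not consulted: an entry is always
allocated. -/
theorem wp_relaxEdge (hF : Fits w J n G.edges.length B)
    (hR : Represents G s l a cnt cur L σ) (hQ : QueueInv l t a cur L lab B)
    (hcnt : cnt ≤ G.edges.length) {c k : ℕ} {u : Fin n} (hk : k < (G.adj u).length)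
    (h15 : σ.reg 15 = c) (hca : c + 1 = a) (h16 : σ.reg 16 = G.offset u + k)
    (hw : 1 ≤ G.weight u (G.adj u)[k])
    (hB : insertLabel c (weightExp (G.weight u (G.adj u)[k])) ≤ B) :
    Wp w G.inputWeights relaxEdge (fun τ =>
      (∃ j, FrontierAt a j (insertLabel c (weightExp (G.weight u (G.adj u)[k]))) ∧
        Represents G s l a (cnt + 1) cur (Function.update L j ((G.adj u)[k] :: L j)) τ) ∧
      τ.reg 15 = c ∧ τ.reg 16 = G.offset u + (k + 1) ∧ τ.reg 17 = σ.reg 17 ∧ τ.out = σ.out ∧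
      τ.time = σ.time + 26) σ := by
  have hmask := hR.mask_lt hF hQ
  have he : G.offset u + k < G.edges.length := by
    have := G.edges_getElem? u k hk
    exact (List.getElem?_eq_some_iff.mp this).1
  obtain ⟨r0, r1, r2, r3, r4, r5, r6, r7, r8, r9, r12, rmask, nxt, vert, flag, head, hmem, hcur,
    hch, hflag⟩ := hR
  obtain ⟨f1, f2, f3, f4⟩ := hF
  have hhead := G.inputMem_head s u k hk
  have hx := G.inputWeights_eq u k hk
  set y := (G.adj u)[k] with hy
  set x := G.weight u y with hxdef
  have hgt := insertLabel_gt c (weightExp x)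
  have hpow := weightExp_pow_le hw
  have hpow' := lt_weightExp_pow hw
  have hfr := hca ▸ insertLabel_frontierAt c (weightExp x)
  rw [pow_add] at hpow hpow'
  have hqlt : weightExp x < 2 ^ weightExp x := Nat.lt_two_pow_self
  have hdiv : c / 2 ^ weightExp x ≤ c := Nat.div_le_self _ _
  have hj := hfr.lt_of_fits ⟨f1, f2, f3, f4⟩ hB
  have hJ : J < 2 ^ J := Nat.lt_two_pow_self
  have h2j : 2 ^ padicValNat 2 (insertLabel c (weightExp x)) < 2 ^ J :=
    Nat.pow_lt_pow_right (by norm_num) hj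
  have hxor : insertLabel c (weightExp x) ^^^ (insertLabel c (weightExp x) - 1) < 2 ^ J :=
    Nat.xor_lt_two_pow (by omega) (by omega)
  have hlogx := log_xor_pred (b := insertLabel c (weightExp x)) (by omega)
  have hlor : σ.reg 11 ||| 2 ^ padicValNat 2 (insertLabel c (weightExp x)) < 2 ^ J :=
    Nat.or_lt_two_pow hmask h2j
  have hheadj := (hch (padicValNat 2 (insertLabel c (weightExp x)))).le
  set b := insertLabel c (weightExp x) with hb
  set j := padicValNat 2 b with hjdef
  unfold relaxEdge
  -- Each instruction is executed symbolically: its value is named, and the bounds collected above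
  -- show that it fits into a word.
  refine wp_op (n + 3 + (G.offset u + k)) (by simp [BinOp.eval, *]) (by omega) ?_
  refine wp_load y (by simpa [hmem, layout_input, he] using hhead) (by omega) ?_
  refine wp_floor ⌊x⌋₊ (by simp [h16, hx]) (by omega) ?_
  refine wp_op (⌊x⌋₊ + 1) (by simp [BinOp.eval, *]) (by omega) ?_
  have hlog : Nat.log 2 (⌊x⌋₊ + 1) ≤ ⌊x⌋₊ + 1 := Nat.log_le_self _ _
  refine wp_log (Nat.log 2 (⌊x⌋₊ + 1)) (by simp) (by omega) ?_
  refine wp_op (weightExp x) (by simp [BinOp.eval, r1, weightExp]) (by omega) ?_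
  refine wp_op (c / 2 ^ weightExp x) (by simp [BinOp.eval, h15, Nat.shiftRight_eq_div_pow])
    (by omega) ?_
  refine wp_op (c / 2 ^ weightExp x + 2) (by simp [BinOp.eval, r2]) (by omega) ?_
  refine wp_op b (by simp [BinOp.eval, Nat.shiftLeft_eq, hb, insertLabel]) (by omega) ?_
  refine wp_op (b - 1) (by simp [BinOp.eval, r1]) (by omega) ?_
  refine wp_op (b ^^^ (b - 1)) (by simp [BinOp.eval]) (by omega) ?_
  refine wp_log j (by simp [hlogx]) (by omega) ?_
  refine wp_op (cnt + 1) (by simp [BinOp.eval, r12, r1]) (by omega) ?_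
  refine wp_op (4 * (cnt + 1)) (by simp [BinOp.eval, r3]) (by omega) ?_
  refine wp_op (4 * (cnt + 1) + (n + 3 + G.edges.length + 1)) (by simp [BinOp.eval, r6])
    (by omega) ?_
  refine wp_store (4 * (cnt + 1) + (n + 3 + G.edges.length + 1)) y (by simp) (by simp) ?_
  refine wp_op (4 * j) (by simp [BinOp.eval, r3]) (by omega) ?_
  refine wp_op (4 * j + (n + 3 + G.edges.length + 3)) (by simp [BinOp.eval, r8]) (by omega) ?_
  refine wp_load (head j) (by simp [hmem, update_layout_one, layout_three]) (by omega) ?_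
  refine wp_op (4 * (cnt + 1) + (n + 3 + G.edges.length)) (by simp [BinOp.eval, r5])
    (by omega) ?_
  refine wp_store (4 * (cnt + 1) + (n + 3 + G.edges.length)) (head j) (by simp) (by simp) ?_
  refine wp_store (4 * j + (n + 3 + G.edges.length + 3)) (cnt + 1) (by simp) (by simp) ?_
  refine wp_op (2 ^ j) (by simp [BinOp.eval, r1, Nat.shiftLeft_eq]) (by omega) ?_
  refine wp_op (σ.reg 11 ||| 2 ^ j) (by simp [BinOp.eval]) (by omega) ?_
  refine wp_op (G.offset u + (k + 1)) (by simp [BinOp.eval, r1, h16, add_assoc]) (by omega) ?_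
  refine wp_skip ⟨⟨j, hfr, ?_⟩, by simp [h15], by simp, by simp, by simp, by simp⟩
  refine ⟨by simp [r0], by simp [r1], by simp [r2], by simp [r3], by simp [r4], by simp [r5],
    by simp [r6], by simp [r7], by simp [r8], by simp [r9], by simp, fun i => ?_, ?_⟩
  · rcases eq_or_ne i j with rfl | hij
    · simp
    · simp [Function.update_of_ne hij, ← rmask, Nat.testBit_two_pow_of_ne hij.symm]
  · refine ⟨Function.update nxt (cnt + 1) (head j), Function.update vert (cnt + 1) y, flag,
      Function.update head j (cnt + 1), ?_, ?_, fun i => ?_, hflag⟩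
    · simp [hmem, update_layout_one, update_layout_zero, update_layout_three]
    · simpa using hcur.alloc _ _
    · rcases eq_or_ne i j with rfl | hij
      · simp only [Function.update_self]
        refine ⟨by omega, le_rfl, by simp, ?_⟩
        simpa using (hch j).alloc _ _
      · simp only [Function.update_of_ne hij]
        exact (hch i).alloc _ _

end Blocks

/-! ### Selection of the next bucket and relaxation of an edge list -/

section Blocks

variable {n : ℕ} {G : WDigraph n} {s : Fin n} {l : List (Fin n)} {a cnt B w J : ℕ}
  {cur : List (Fin n)} {L : ℕ → List (Fin n)} {lab : ℕ → ℕ} {σ : Config} {t : Fin n → ℕ∞}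

theorem wp_selectBucket (hF : Fits w J n G.edges.length B)
    (hR : Represents G s l a cnt [] L σ) (hQ : QueueInv l t a [] L lab B) (hM : σ.reg 11 ≠ 0) :
    Wp w G.inputWeights selectBucket (fun τ => ∃ j, L j ≠ [] ∧ (∀ i, L i ≠ [] → lab j ≤ lab i) ∧
      τ.reg 14 = j ∧ Represents G s l (lab j) cnt [] L τ ∧ τ.out = σ.out ∧
      τ.time = σ.time + 15) σ := by
  have hmask := hR.mask_lt hF hQ
  have haB := hQ.le_bound
  obtain ⟨r0, r1, r2, r3, r4, r5, r6, r7, r8, r9, r12, rmask, hmemory⟩ := hR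
  obtain ⟨f1, f2, f3, f4⟩ := hF
  set M := σ.reg 11 with hMdef
  have hx1 : M ^^^ (M - 1) < 2 ^ J := Nat.xor_lt_two_pow hmask (by omega)
  have hlog1 := log_xor_pred hM
  have hN := lt_nextMultiple a (padicValNat 2 M)
  have hN' := nextMultiple_le_add a (padicValNat 2 M)
  have hi := testBit_padicValNat hM
  have hsel := lab_eq_nextMultiple (a := a) hQ.frontier rmask
  have hsel' := lab_eq_nextMultiple_add (a := a) hQ.frontier rmask hM
  have h2i : 2 ^ padicValNat 2 M ≤ M := Nat.le_of_dvd (by omega) pow_padicValNat_dvd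
  have hii : padicValNat 2 M < 2 ^ padicValNat 2 M := Nat.lt_two_pow_self
  set i := padicValNat 2 M with hidef
  set N := nextMultiple a i with hNdef
  have h2m : 2 ^ padicValNat 2 N ≤ N := Nat.le_of_dvd (by omega) pow_padicValNat_dvd
  have hmm : padicValNat 2 N < 2 ^ padicValNat 2 N := Nat.lt_two_pow_self
  -- The next multiple need not be a label in use and may exceed `B`, but `N ≤ a + 2 ^ i` needs only
  -- one extra bit.
  have hx2 : N ^^^ (N - 1) < 2 ^ (J + 1) :=
    Nat.xor_lt_two_pow (by rw [pow_succ]; omega) (by rw [pow_succ]; omega)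
  have hlog2 := log_xor_pred (b := N) (by omega)
  rw [pow_succ] at hx2
  have hdiv : a / 2 ^ i ≤ a := Nat.div_le_self _ _
  have hand := Nat.and_two_pow M (padicValNat 2 N)
  have hand' : M &&& 2 ^ padicValNat 2 N ≤ M := Nat.and_le_left
  set m := padicValNat 2 N with hmdef
  unfold selectBucket
  refine wp_op (M - 1) (by simp [BinOp.eval, r1, hMdef]) (by omega) ?_
  refine wp_op (M ^^^ (M - 1)) (by simp [BinOp.eval, hMdef]) (by omega) ?_
  refine wp_log i (by simp [hlog1]) (by omega) ?_
  refine wp_op (a / 2 ^ i) (by simp [BinOp.eval, r9, Nat.shiftRight_eq_div_pow]) (by omega) ?_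
  refine wp_op (a / 2 ^ i + 1) (by simp [BinOp.eval, r1]) (by omega) ?_
  refine wp_op N (by simp [BinOp.eval, Nat.shiftLeft_eq, hNdef, nextMultiple]) (by omega) ?_
  refine wp_op (N - 1) (by simp [BinOp.eval, r1]) (by omega) ?_
  refine wp_op (N ^^^ (N - 1)) (by simp [BinOp.eval]) (by omega) ?_
  refine wp_log m (by simp [hlog2]) (by omega) ?_
  refine wp_op (2 ^ m) (by simp [BinOp.eval, r1, Nat.shiftLeft_eq]) (by omega) ?_
  refine wp_op (M &&& 2 ^ m) (by simp [BinOp.eval, hMdef]) (by omega) ?_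
  refine wp_ifLt (fun h => ?_) (fun h => ?_)
  · have hbit : M.testBit m = true := by
      by_contra hne
      simp only [Bool.not_eq_true] at hne
      rw [hne] at hand
      simp [r0, hand] at h
    obtain ⟨hl1, hl2⟩ := hsel hbit
    refine wp_op N (by simp [BinOp.eval, r0]) (by omega) ?_
    refine wp_op m (by simp [BinOp.eval, r0]) (by omega) ?_
    refine wp_skip ⟨m, (rmask m).mp hbit, by rwa [hl1], by simp, ?_, by simp, by simp⟩
    rw [hl1]
    exact ⟨by simp [r0], by simp [r1], by simp [r2], by simp [r3], by simp [r4], by simp [r5],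
      by simp [r6], by simp [r7], by simp [r8], by simp, by simp [r12], by simpa using rmask,
      by simpa using hmemory⟩
  · have hbit : ¬ M.testBit m = true := by
      intro hne
      rw [hne] at hand
      simp [r0, hand] at h
    obtain ⟨hl1, hl2⟩ := hsel' hbit
    refine wp_op (2 ^ i) (by simp [BinOp.eval, r1, Nat.shiftLeft_eq]) (by omega) ?_
    refine wp_op (N + 2 ^ i) (by simp [BinOp.eval]) (by omega) ?_
    refine wp_skip ⟨i, (rmask i).mp hi, by rwa [hl1], by simp, ?_, by simp, by simp⟩
    rw [hl1]
    exact ⟨by simp [r0], by simp [r1], by simp [r2], by simp [r3], by simp [r4], by simp [r5],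
      by simp [r6], by simp [r7], by simp [r8], by simp, by simp [r12], by simpa using rmask,
      by simpa using hmemory⟩

theorem wp_takeBucket (hF : Fits w J n G.edges.length B) (hcnt : cnt ≤ G.edges.length + 1)
    (hR : Represents G s l a cnt [] L σ) {j : ℕ} (hj : L j ≠ []) (hjJ : j < J)
    (hmask : σ.reg 11 < 2 ^ J) (h14 : σ.reg 14 = j) :
    Wp w G.inputWeights takeBucket (fun τ =>
      Represents G s l a cnt (L j) (Function.update L j []) τ ∧ τ.out = σ.out ∧
      τ.time = σ.time + 7) σ := by
  obtain ⟨r0, r1, r2, r3, r4, r5, r6, r7, r8, r9, r12, rmask, nxt, vert, flag, head, hmem, hcur,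
    hch, hflag⟩ := hR
  obtain ⟨f1, f2, f3, f4⟩ := hF
  have hJ : J < 2 ^ J := Nat.lt_two_pow_self
  have h2j : 2 ^ j < 2 ^ J := Nat.pow_lt_pow_right (by norm_num) hjJ
  have hx : σ.reg 11 ^^^ 2 ^ j < 2 ^ J := Nat.xor_lt_two_pow hmask h2j
  have hheadj := (hch j).le
  unfold takeBucket
  refine wp_op (2 ^ j) (by simp [BinOp.eval, r1, h14, Nat.shiftLeft_eq]) (by omega) ?_
  refine wp_op (σ.reg 11 ^^^ 2 ^ j) (by simp [BinOp.eval]) (by omega) ?_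
  refine wp_op (4 * j) (by simp [BinOp.eval, r3, h14]) (by omega) ?_
  refine wp_op (4 * j + (n + 3 + G.edges.length + 3)) (by simp [BinOp.eval, r8]) (by omega) ?_
  refine wp_load (head j) (by simp [hmem, layout_three]) (by omega) ?_
  refine wp_store (4 * j + (n + 3 + G.edges.length + 3)) 0 (by simp) (by simp [r0]) ?_
  refine wp_skip ⟨⟨by simp [r0], by simp [r1], by simp [r2], by simp [r3], by simp [r4],
    by simp [r5], by simp [r6], by simp [r7], by simp [r8], by simp [r9], by simp [r12],
    fun i => ?_, nxt, vert, flag, Function.update head j 0, ?_, ?_, fun i => ?_, hflag⟩,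
    by simp, by simp⟩
  · rcases eq_or_ne i j with rfl | hij
    · simpa using (rmask i).mpr hj
    · simp [Function.update_of_ne hij, ← rmask, Nat.testBit_two_pow_of_ne hij.symm]
  · simp [hmem, update_layout_three]
  · simpa using hch j
  · rcases eq_or_ne i j with rfl | hij
    · simp [Chain]
    · simpa only [Function.update_of_ne hij] using hch i

/-- The relaxations of the edges from `u` to the vertices of `vs`, from the bucket `c`. -/
noncomputable def relaxPart (G : WDigraph n) (t : Fin n → ℕ∞) (u : Fin n) (c : ℕ)
    (vs : List (Fin n)) : Fin n → ℕ∞ := fun v =>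
  if v ∈ vs then min (t v) (insertBucket c (G.weight u v) : ℕ∞) else t v

theorem relaxPart_of_mem {u v : Fin n} {c : ℕ} {vs : List (Fin n)} (h : v ∈ vs) :
    relaxPart G t u c vs v = min (t v) (insertBucket c (G.weight u v) : ℕ∞) := if_pos h

theorem relaxPart_of_notMem {u v : Fin n} {c : ℕ} {vs : List (Fin n)} (h : v ∉ vs) :
    relaxPart G t u c vs v = t v := if_neg h

theorem relaxPart_nil (t : Fin n → ℕ∞) (u : Fin n) (c : ℕ) : relaxPart G t u c [] = t := by
  funext v
  simp [relaxPart]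

theorem relaxPart_adj (t : Fin n → ℕ∞) (u : Fin n) :
    relaxPart G t u (t u).toNat (G.adj u) = relax G t u := by
  funext v
  simp [relaxPart, relax]

/-- The number of vertices in the queue, counted with their multiplicities. -/
def queueSize (J : ℕ) (cur : List (Fin n)) (L : ℕ → List (Fin n)) : ℕ :=
  cur.length + ∑ j ∈ Finset.range J, (L j).length

theorem queueSize_cons (J : ℕ) (v : Fin n) (cur : List (Fin n)) (L : ℕ → List (Fin n)) :
    queueSize J (v :: cur) L = queueSize J cur L + 1 := by
  simp only [queueSize, List.length_cons]
  omega

theorem queueSize_push {j : ℕ} (hj : j < J) (v : Fin n) :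
    queueSize J cur (Function.update L j (v :: L j)) = queueSize J cur L + 1 := by
  unfold queueSize
  have h : ∀ f : ℕ → List (Fin n), ∑ i ∈ Finset.range J, (f i).length =
      (f j).length + ∑ i ∈ Finset.range J \ {j}, (f i).length := fun f =>
    Finset.sum_eq_add_sum_sdiff_singleton_of_mem (Finset.mem_range.mpr hj) _
  rw [h, h L, Function.update_self, List.length_cons]
  have : ∑ i ∈ Finset.range J \ {j}, (Function.update L j (v :: L j) i).length =
      ∑ i ∈ Finset.range J \ {j}, (L i).length := by
    refine Finset.sum_congr rfl fun i hi => ?_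
    rw [Function.update_of_ne (by simpa using (Finset.mem_sdiff.mp hi).2)]
  rw [this]
  omega

theorem queueSize_take {j : ℕ} (hj : j < J) :
    queueSize J (L j) (Function.update L j []) = queueSize J [] L := by
  unfold queueSize
  have h : ∀ f : ℕ → List (Fin n), ∑ i ∈ Finset.range J, (f i).length =
      (f j).length + ∑ i ∈ Finset.range J \ {j}, (f i).length := fun f =>
    Finset.sum_eq_add_sum_sdiff_singleton_of_mem (Finset.mem_range.mpr hj) _
  rw [h, h L, Function.update_self]
  have : ∑ i ∈ Finset.range J \ {j}, (Function.update L j [] i).length =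
      ∑ i ∈ Finset.range J \ {j}, (L i).length := by
    refine Finset.sum_congr rfl fun i hi => ?_
    rw [Function.update_of_ne (by simpa using (Finset.mem_sdiff.mp hi).2)]
  rw [this]
  simp

/-- The loop invariant says that exactly the first `k` heads have been relaxed from the fixed label
`c`. An iteration costs 26 steps and one test. -/
theorem wp_relaxEdges (hF : Fits w J n G.edges.length B)
    (hR : Represents G s l a cnt cur L σ) (hQ : QueueInv l t a cur L lab B) {c : ℕ} {u : Fin n}
    (hcnt : cnt + G.degree u ≤ G.edges.length + 1)
    (h15 : σ.reg 15 = c) (hca : c + 1 = a) (h16 : σ.reg 16 = G.offset u)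
    (h17 : σ.reg 17 = G.offset u + G.degree u)
    (hw : ∀ v ∈ G.adj u, 1 ≤ G.weight u v)
    (hB : ∀ v ∈ G.adj u, insertBucket c (G.weight u v) + 1 ≤ B) :
    Wp w G.inputWeights (.whileLt 16 17 relaxEdge) (fun τ => ∃ L' lab',
      Represents G s l a (cnt + G.degree u) cur L' τ ∧
      QueueInv l (relaxPart G t u c (G.adj u)) a cur L' lab' B ∧
      queueSize J cur L' = queueSize J cur L + G.degree u ∧
      τ.out = σ.out ∧ τ.time = σ.time + 27 * G.degree u + 1) σ := by
  let I : ℕ → Config → Prop := fun N τ => ∃ k L' lab', N + k = G.degree u ∧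
      Represents G s l a (cnt + k) cur L' τ ∧
      QueueInv l (relaxPart G t u c ((G.adj u).take k)) a cur L' lab' B ∧
      queueSize J cur L' = queueSize J cur L + k ∧ τ.reg 15 = c ∧ τ.reg 16 = G.offset u + k ∧
      τ.reg 17 = G.offset u + G.degree u ∧ τ.out = σ.out ∧ τ.time = σ.time + 27 * k
  refine wp_while I ?_ ?_ (N := G.degree u) ?_
  · rintro N τ ⟨k, L', lab', hN, hR', hQ', hS, e15, e16, e17, eo, et⟩ hlt
    have hk : k < (G.adj u).length := by
      rw [e16, e17, G.degree_eq] at hlt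
      dsimp only at hlt
      omega
    have hmem : (G.adj u)[k] ∈ G.adj u := List.getElem_mem hk
    have hR'' : Represents G s l a (cnt + k) cur L' τ.tick :=
      ⟨hR'.r0, hR'.r1, hR'.r2, hR'.r3, hR'.r4, hR'.r5, hR'.r6, hR'.r7, hR'.r8, hR'.r9, hR'.r12,
        hR'.mask, hR'.memory⟩
    have hins := insertBucket_eq (c := c) (hw _ hmem)
    have hBk := hB _ hmem
    have hdeg : k < G.degree u := hk
    refine (wp_relaxEdge hF hR'' hQ' (by omega) hk e15 hca e16 (hw _ hmem)
      (by rw [← hins]; exact hBk)).mono ?_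
    rintro υ ⟨⟨j, hfr, hR3⟩, u15, u16, u17, uo, ut⟩
    rw [← hins] at hfr
    refine ⟨N - 1, by omega, k + 1, _, _, by omega, hR3, hQ'.push hfr hBk ?_ ?_, ?_, u15, u16,
      u17.trans e17, uo.trans eo, ?_⟩
    -- As no edge is listed twice, each head is relaxed once, so the sequential relaxations agree
    -- with the simultaneous one of `relax`.
    · have hnot : (G.adj u)[k] ∉ (G.adj u).take k := by
        intro h
        obtain ⟨i, hi, hik⟩ := List.mem_take_iff_getElem.mp h
        have := (G.nodup u).getElem_inj_iff.mp hik
        omega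
      have hin : (G.adj u)[k] ∈ (G.adj u).take (k + 1) := by
        rw [List.take_succ_eq_append_getElem hk]
        exact List.mem_append_right _ (List.mem_singleton.mpr rfl)
      exact (relaxPart_of_mem hin).trans
        (congrArg (min · _) (relaxPart_of_notMem hnot).symm)
    · intro v hv
      have : v ∈ (G.adj u).take (k + 1) ↔ v ∈ (G.adj u).take k := by
        rw [List.take_succ_eq_append_getElem hk, List.mem_append, List.mem_singleton]
        exact or_iff_left hv
      simp only [relaxPart, this]
    · rw [queueSize_push (hfr.lt_of_fits hF hBk), hS]
      omega
    · simp only [Config.tick_time] at ut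
      omega
  · rintro N τ ⟨k, L', lab', hN, hR', hQ', hS, e15, e16, e17, eo, et⟩ hlt
    have hk : k = G.degree u := by omega
    subst hk
    rw [show (G.adj u).take (G.degree u) = G.adj u from List.take_length] at hQ'
    refine ⟨L', lab', ?_, hQ', hS, eo, by simp [et]⟩
    exact ⟨hR'.r0, hR'.r1, hR'.r2, hR'.r3, hR'.r4, hR'.r5, hR'.r6, hR'.r7, hR'.r8, hR'.r9, hR'.r12,
        hR'.mask, hR'.memory⟩
  · exact ⟨0, L, lab, by omega, hR, by rwa [List.take_zero, relaxPart_nil], rfl, h15, by simpa,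
      h17, rfl, by simp⟩

end Blocks

/-! ### Visits, the main loop and its amortized cost -/

section Blocks

variable {n : ℕ} {G : WDigraph n} {s : Fin n} {l : List (Fin n)} {a cnt B w J : ℕ}
  {cur : List (Fin n)} {L : ℕ → List (Fin n)} {lab : ℕ → ℕ} {σ : Config} {t : Fin n → ℕ∞}

theorem wp_visitVertex (hF : Fits w J n G.edges.length B) {u : Fin n} {c : ℕ}
    (hR : Represents G s l a cnt cur L σ) (hQ : QueueInv (l ++ [u]) t a cur L lab B)
    (hcnt : cnt + G.degree u ≤ G.edges.length + 1) (hca : c + 1 = a) (h14 : σ.reg 14 = u)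
    (h18 : σ.reg 18 = 4 * u + (n + 3 + G.edges.length + 2))
    (hw : ∀ v ∈ G.adj u, 1 ≤ G.weight u v)
    (hB : ∀ v ∈ G.adj u, insertBucket c (G.weight u v) + 1 ≤ B) :
    Wp w G.inputWeights visitVertex (fun τ => ∃ L' lab',
      Represents G s (l ++ [u]) a (cnt + G.degree u) cur L' τ ∧
      QueueInv (l ++ [u]) (relaxPart G t u c (G.adj u)) a cur L' lab' B ∧
      queueSize J cur L' = queueSize J cur L + G.degree u ∧
      τ.out = σ.out ++ [(σ.time + 3, (u : ℕ), c)] ∧ τ.time = σ.time + 27 * G.degree u + 8) σ := by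
  obtain ⟨r0, r1, r2, r3, r4, r5, r6, r7, r8, r9, r12, rmask, nxt, vert, flag, head, hmem, hcur,
    hch, hflag⟩ := hR
  have hF' := hF
  obtain ⟨f1, f2, f3, f4⟩ := hF
  have haB := hQ.le_bound
  have hu := u.isLt
  have ho1 := G.inputMem_offset s (i := u) (by omega)
  have ho2 := G.inputMem_offset s (i := u + 1) (by omega)
  have hos := G.offset_succ u
  have hle : G.offset (u + 1) ≤ G.edges.length := by
    rw [← G.offset_card]
    unfold WDigraph.offset
    rw [List.take_of_length_le (i := n) (by simp)]
    exact G.sum_take_degree_le _ _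
  rw [show (u : ℕ) + 1 + 2 = u + 2 + 1 by omega] at ho2
  unfold visitVertex
  refine wp_store _ 1 h18 r1 ?_
  refine wp_op c (by simp [BinOp.eval, r9, r1, ← hca]) (by omega) ?_
  refine wp_output u c (by simp [h14]) (by simp) ?_
  refine wp_op (u + 2) (by simp [BinOp.eval, h14, r2]) (by omega) ?_
  refine wp_load (G.offset u) ?_ (by omega) ?_
  · simp only [Config.setReg_mem, Config.emit_mem, Config.setMem_mem, Config.setReg_reg,
      Function.update_self, hmem, update_layout_two]
    rw [layout_input _ _ _ _ _ _ _ (by omega), ho1]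
  refine wp_op (u + 2 + 1) (by simp [BinOp.eval, r1]) (by omega) ?_
  refine wp_load (G.offset u + G.degree u) ?_ (by omega) ?_
  · simp only [Config.setReg_mem, Config.emit_mem, Config.setMem_mem, Config.setReg_reg,
      Function.update_self, hmem, update_layout_two]
    rw [layout_input _ _ _ _ _ _ _ (by omega), ho2, hos]
  refine (wp_relaxEdges (l := l ++ [u]) (s := s) (cnt := cnt) hF' ?_ hQ (u := u) (c := c) hcnt
    (by simp) hca (by simp) (by simp) hw hB).mono ?_
  · refine ⟨by simp [r0], by simp [r1], by simp [r2], by simp [r3], by simp [r4],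
      by simp [r5], by simp [r6], by simp [r7], by simp [r8], by simp [r9], by simp [r12],
      by simpa using rmask, nxt, vert, Function.update flag u 1, head, ?_, by simpa using hcur,
      hch, fun v => ?_⟩
    · simp [hmem, update_layout_two]
    · rcases eq_or_ne v u with rfl | hv
      · simp
      · rw [Function.update_of_ne (fun h => hv (Fin.ext h)), hflag v]
        simp [hv]
  · rintro τ ⟨L', lab', h1, h2, h3, h4, h5⟩
    refine ⟨L', lab', h1, h2, h3, by simp [h4], ?_⟩
    rw [h5]
    simp only [Config.setReg_time, Config.emit_time, Config.setMem_time]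
    omega

/-- Stated with an arbitrary postcondition, so that the two cases can be continued separately, with
different runs and labels. -/
theorem wp_popVertex {Q : Config → Prop} {v : Fin n} (hF : Fits w J n G.edges.length B)
    (hcnt : cnt ≤ G.edges.length + 1) (hR : Represents G s l a cnt (v :: cur) L σ)
    (hvisited : v ∈ l → ∀ τ, Represents G s l a cnt cur L τ → τ.out = σ.out →
      τ.time = σ.time + 10 → Q τ)
    (hvisit : v ∉ l → ∀ τ, Represents G s l a cnt cur L τ → τ.reg 14 = v →
      τ.reg 18 = 4 * v + (n + 3 + G.edges.length + 2) → τ.out = σ.out → τ.time = σ.time + 9 →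
      Wp w G.inputWeights visitVertex Q τ) :
    Wp w G.inputWeights popVertex Q σ := by
  obtain ⟨r0, r1, r2, r3, r4, r5, r6, r7, r8, r9, r12, rmask, nxt, vert, flag, head, hmem, hcur,
    hch, hflag⟩ := hR
  obtain ⟨f1, f2, f3, f4⟩ := hF
  have hv := v.isLt
  obtain ⟨p1, p2, p3, p4⟩ := hcur
  have p5 := p4.le
  set p := σ.reg 10 with hp
  unfold popVertex
  refine wp_op (4 * p) (by simp [BinOp.eval, r3, hp]) (by omega) ?_
  refine wp_op (4 * p + (n + 3 + G.edges.length + 1)) (by simp [BinOp.eval, r6]) (by omega) ?_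
  refine wp_load v (by simp [hmem, layout_one, p3]) (by omega) ?_
  refine wp_op (4 * p + (n + 3 + G.edges.length)) (by simp [BinOp.eval, r5]) (by omega) ?_
  refine wp_load (nxt p) (by simp [hmem, layout_zero]) (by omega) ?_
  refine wp_op (4 * v) (by simp [BinOp.eval, r3]) (by omega) ?_
  refine wp_op (4 * v + (n + 3 + G.edges.length + 2)) (by simp [BinOp.eval, r7]) (by omega) ?_
  refine wp_load (flag v) (by simp [hmem, layout_two]) (by rw [hflag]; split_ifs <;> omega) ?_
  refine wp_ifLt (fun h => ?_) (fun h => ?_)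
  · have hvl : v ∉ l := by
      intro hvl
      simp [hflag, hvl, r1] at h
    refine hvisit hvl _ ?_ (by simp) (by simp) (by simp) (by simp)
    exact ⟨by simp [r0], by simp [r1], by simp [r2], by simp [r3], by simp [r4],
      by simp [r5], by simp [r6], by simp [r7], by simp [r8], by simp [r9], by simp [r12],
      by simpa using rmask, nxt, vert, flag, head, by simpa using hmem, by simpa using p4, hch,
      hflag⟩
  · have hvl : v ∈ l := by
      by_contra hvl
      simp [hflag, hvl, r1] at h
    refine wp_skip (hvisited hvl _ ?_ (by simp) (by simp))
    exact ⟨by simp [r0], by simp [r1], by simp [r2], by simp [r3], by simp [r4],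
      by simp [r5], by simp [r6], by simp [r7], by simp [r8], by simp [r9], by simp [r12],
      by simpa using rmask, nxt, vert, flag, head, by simpa using hmem, by simpa using p4, hch,
      hflag⟩

theorem Represents.tick (hR : Represents G s l a cnt cur L σ) :
    Represents G s l a cnt cur L σ.tick :=
  ⟨hR.r0, hR.r1, hR.r2, hR.r3, hR.r4, hR.r5, hR.r6, hR.r7, hR.r8, hR.r9, hR.r12, hR.mask,
    hR.memory⟩

theorem Represents.pos_iff (hR : Represents G s l a cnt cur L σ) : 0 < σ.reg 10 ↔ cur ≠ [] :=
  let ⟨_, _, _, _, _, hcur, _, _⟩ := hR.memory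
  hcur.pos_iff

theorem Represents.le (hR : Represents G s l a cnt cur L σ) : σ.reg 10 ≤ cnt :=
  let ⟨_, _, _, _, _, hcur, _, _⟩ := hR.memory
  hcur.le

/-- If the queue is not empty, then afterwards the current bucket is not empty. -/
theorem wp_fetch (hF : Fits w J n G.edges.length B) (hcnt : cnt ≤ G.edges.length + 1)
    (hR : Represents G s l a cnt cur L σ) (hQ : QueueInv l t a cur L lab B)
    (hpos : 0 < σ.reg 10 + σ.reg 11) :
    Wp w G.inputWeights (.ifLt 0 10 .skip (selectBucket ⨾ takeBucket)) (fun τ => ∃ a' v cur' L',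
      Represents G s l a' cnt (v :: cur') L' τ ∧ QueueInv l t a' (v :: cur') L' lab B ∧
      queueSize J (v :: cur') L' = queueSize J cur L ∧ τ.out = σ.out ∧
      τ.time ≤ σ.time + 23) σ := by
  refine wp_ifLt (fun h => ?_) (fun h => ?_)
  · rw [hR.r0, hR.pos_iff] at h
    obtain ⟨v, cur', rfl⟩ := List.exists_cons_of_ne_nil h
    exact wp_skip ⟨a, v, cur', L, hR.tick.tick, hQ, rfl, rfl, by simp⟩
  · have h' := h
    rw [hR.r0, hR.pos_iff, not_not] at h'
    subst h'
    rw [hR.r0] at h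
    refine wp_seq ((wp_selectBucket hF hR.tick hQ (by simp only [Config.tick_reg]; omega)).mono ?_)
    rintro τ ⟨j, hj, hmin, h14, hRτ, hout, htime⟩
    have hjJ := (hQ.frontier j hj).lt_of_fits hF (hQ.lab_le j hj)
    have hmask : τ.reg 11 < 2 ^ J := by
      refine Nat.lt_pow_two_of_testBit _ fun i hi => ?_
      by_contra hne
      have hL := (hRτ.mask i).mp (by simpa using hne)
      exact absurd ((hQ.frontier i hL).lt_of_fits hF (hQ.lab_le i hL)) (by omega)
    refine (wp_takeBucket hF hcnt hRτ hj hjJ hmask h14).mono ?_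
    rintro υ ⟨h1, h2, h3⟩
    have hadv := hQ.advance hj hmin
    have hsize := queueSize_take (L := L) hjJ
    obtain ⟨v, cur', hv⟩ := List.exists_cons_of_ne_nil hj
    rw [hv] at h1 hadv hsize
    refine ⟨_, v, cur', _, h1, hadv, ?_, h2.trans hout, ?_⟩
    · exact hsize
    · rw [h3, htime]
      simp

/-- The output consists of the visited vertices with their labels, and it was made in time. -/
def OutputOk (G : WDigraph n) (C : ℕ) (l : List (Fin n)) (t : Fin n → ℕ∞)
    (out : List (ℕ × ℕ × ℕ)) : Prop :=
  out.length = l.length ∧ ∀ (i : ℕ) (hi : i < l.length), ∃ T x : ℕ,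
    out[i]? = some (T, (l[i] : ℕ), x) ∧ t l[i] = (x : ℕ∞) ∧
    T ≤ C * (1 + ((l.take (i + 1)).map G.degree).sum)

theorem OutputOk.snoc {C T x : ℕ} {out : List (ℕ × ℕ × ℕ)} {t' : Fin n → ℕ∞} {u : Fin n}
    (h : OutputOk G C l t out) (ht : ∀ v ∈ l, t' v = t v) (hu : t' u = x)
    (hT : T ≤ C * (1 + (l.map G.degree).sum)) :
    OutputOk G C (l ++ [u]) t' (out ++ [(T, (u : ℕ), x)]) := by
  obtain ⟨h1, h2⟩ := h
  refine ⟨by simp [h1], fun i hi => ?_⟩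
  rcases Nat.lt_or_ge i l.length with hil | hil
  · obtain ⟨T', x', h3, h4, h5⟩ := h2 i hil
    refine ⟨T', x', ?_, ?_, ?_⟩
    · rw [List.getElem?_append_left (by omega), h3, List.getElem_append_left hil]
    · rw [List.getElem_append_left hil, ht _ (List.getElem_mem hil), h4]
    · rwa [List.take_append_of_le_length (by omega)]
  · have hil' : i = l.length := by
      simp only [List.length_append, List.length_singleton] at hi
      omega
    subst hil'
    refine ⟨T, x, ?_, ?_, ?_⟩
    · rw [List.getElem?_append_right (by omega)]
      simp [h1]
    · simpa using hu
    · refine hT.trans ?_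
      rw [List.take_of_length_le (by simp), List.map_append, List.sum_append]
      gcongr
      omega

/-- The invariant of the main loop; `N` bounds the number of its remaining iterations. -/
def LoopInv (G : WDigraph n) (s : Fin n) (B J N : ℕ) (σ : Config) : Prop :=
  ∃ l t a cur L lab, PartialRun G s l t ∧ QueueInv l t a cur L lab B ∧
    Represents G s l a (1 + (l.map G.degree).sum) cur L σ ∧ σ.reg 13 = σ.reg 10 + σ.reg 11 ∧
    σ.time + 50 * queueSize J cur L + 20 ≤ 100 * (1 + (l.map G.degree).sum) ∧
    OutputOk G 100 l t σ.out ∧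
    N + (l.map G.degree).sum = queueSize J cur L + G.edges.length

theorem Represents.setReg_go (hR : Represents G s l a cnt cur L σ) (x : ℕ) :
    Represents G s l a cnt cur L (σ.setReg 13 x) :=
  ⟨by simp [hR.r0], by simp [hR.r1], by simp [hR.r2], by simp [hR.r3], by simp [hR.r4],
    by simp [hR.r5], by simp [hR.r6], by simp [hR.r7], by simp [hR.r8], by simp [hR.r9],
    by simp [hR.r12], by simpa using hR.mask, by simpa using hR.memory⟩

/-- Every entry in the queue carries a credit of 50 steps. The removed entry pays for the iteration
apart from its relaxations, at most 43 steps; each edge brings 100, of which 27 pay for its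
relaxation and 50 go to its new entry. The termination measure counts queued entries and unrelaxed
edges: a relaxation turns one into the other, and each iteration removes an entry. -/
theorem wp_loopBody {N₀ N : ℕ} (hw : ∀ u, ∀ v ∈ G.adj u, 1 ≤ G.weight u v)
    (hN : ∀ u, ∀ v ∈ G.adj u, ⌊G.weight u v⌋₊ ≤ N₀) (hB : n * N₀ + 1 ≤ B)
    (hF : Fits w J n G.edges.length B) (hI : LoopInv G s B J N σ) (h13 : σ.reg 0 < σ.reg 13) :
    Wp w G.inputWeights loopBody (fun τ => ∃ N' < N, LoopInv G s B J N' τ) σ.tick := by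
  obtain ⟨l, t, a, cur, L, lab, hrun, hQ, hR, hgo, htime, hout, hNeq⟩ := hI
  have hfacts := hrun.facts hw hN
  have hcnt : 1 + (l.map G.degree).sum ≤ G.edges.length + 1 := by
    have := G.sum_degree_le hfacts.nodup
    omega
  rw [hR.r0, hgo] at h13
  unfold loopBody
  refine wp_seq ((wp_fetch hF hcnt hR.tick hQ h13).mono ?_)
  rintro σ₁ ⟨a', u, cur', L', hR₁, hQ₁, hsize₁, hout₁, htime₁⟩
  simp only [Config.tick_time, Config.tick_out] at hout₁ htime₁
  rw [queueSize_cons] at hsize₁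
  have hgo' : ∀ {l' : List (Fin n)} {t' cnt' L'' lab'' τ}, cnt' ≤ G.edges.length + 1 →
      Represents G s l' a' cnt' cur' L'' τ → QueueInv l' t' a' cur' L'' lab'' B →
      τ.reg 10 + τ.reg 11 < 2 ^ w := by
    intro l' t' cnt' L'' lab'' τ h1 h2 h3
    have e1 := h2.le
    have e2 := h2.mask_lt hF h3
    have e3 := hF.word
    have e4 := hF.edges
    omega
  refine wp_seq (wp_popVertex hF hcnt hR₁ ?_ ?_)
  · intro hul σ₂ hR₂ hout₂ htime₂
    have hQ₂ := hQ₁.pop_visited hul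
    refine wp_op _ rfl (hgo' hcnt hR₂ hQ₂) (wp_skip ⟨N - 1, by omega, l, t, a', cur', L', lab, hrun,
      hQ₂, (hR₂.setReg_go _).tick, by simp [BinOp.eval], ?_, ?_, by omega⟩)
    · simp only [Config.tick_time, Config.setReg_time]
      omega
    · simpa [hout₂, hout₁] using hout
  · intro hul σ₂ hR₂ h14 h18 hout₂ htime₂
    have hta := hQ₁.head_eq hul
    obtain ⟨c, hc⟩ : ∃ c : ℕ, (c : ℕ∞) = t u := by
      apply ENat.ne_top_iff_exists.mp
      intro htop
      rw [htop] at hta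
      simp at hta
    have hca : c + 1 = a' := by
      rw [← hc] at hta
      exact_mod_cast hta
    have hut : t u ≠ ⊤ := by simp [← hc]
    have hrun' : PartialRun G s (l ++ [u]) (relax G t u) :=
      hrun.visit hul hut fun v hv => hQ₁.head_le hul hv
    have hfacts' := hrun'.facts hw hN
    have hlen : l.length + 1 ≤ n := by
      simpa using hfacts'.nodup.length_le_card
    have hsum : ((l ++ [u]).map G.degree).sum = (l.map G.degree).sum + G.degree u := by simp
    have hcnt' := G.sum_degree_le hfacts'.nodup
    rw [hsum] at hcnt'
    have hcb := hfacts.bound u c hc.symm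
    have hins : ∀ v ∈ G.adj u, insertBucket c (G.weight u v) + 1 ≤ B := by
      intro v hv
      have e1 := insertBucket_le (c := c) (hw u v hv)
      have e2 := hN u v hv
      have e3 : (l.length + 1) * N₀ ≤ n * N₀ := Nat.mul_le_mul_right _ hlen
      rw [add_mul, one_mul] at e3
      omega
    -- Once `u` counts as visited, its entry is no longer needed and can be dropped.
    have hQ₂ := hQ₁.visit.pop_visited (v := u) (by simp)
    refine (wp_visitVertex hF hR₂ hQ₂ (by omega) hca h14 h18 (hw u) hins).mono ?_
    rintro σ₃ ⟨L₃, lab₃, hR₃, hQ₃, hsize₃, hout₃, htime₃⟩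
    have hrel : relaxPart G t u c (G.adj u) = relax G t u := by
      rw [← relaxPart_adj, ← hc, ENat.toNat_natCast]
    rw [hrel] at hQ₃
    refine wp_op _ rfl (hgo' (by omega) hR₃ hQ₃) (wp_skip ⟨N - 1, by omega, l ++ [u], relax G t u,
      a', cur', L₃, lab₃, hrun', hQ₃, ?_, by simp [BinOp.eval], ?_, ?_, ?_⟩)
    · rw [hsum, ← add_assoc]
      exact (hR₃.setReg_go _).tick
    · simp only [Config.tick_time, Config.setReg_time]
      omega
    · simp only [Config.tick_out, Config.setReg_out]
      rw [hout₃, hout₂, hout₁]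
      -- The output precedes the relaxations from `u`, so its time fits into the budget of the
      -- earlier vertices alone.
      refine hout.snoc (fun v hv => relax_eq hw hut (hfacts.visited_le v hv u hul)) ?_ (by omega)
      rw [relax_eq hw hut le_rfl, hc]
    · omega

theorem wp_setup (hF : Fits w J n G.edges.length B) (hB : 1 ≤ B) (hreg : σ.reg = fun _ => 0)
    (hmem : σ.mem = layout (G.inputMem s) (n + 3 + G.edges.length) (fun _ => 0) (fun _ => 0)
      (fun _ => 0) (fun _ => 0)) (htime : σ.time = 0) (hout : σ.out = []) :
    Wp w G.inputWeights setup (LoopInv G s B J (1 + G.edges.length)) σ := by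
  obtain ⟨f1, f2, f3, f4⟩ := hF
  have hs := s.isLt
  have hm := G.inputMem_offset s (le_refl n)
  rw [G.offset_card] at hm
  unfold setup
  refine wp_const 1 (by omega) ?_
  refine wp_const 2 (by omega) ?_
  refine wp_const 4 (by omega) ?_
  refine wp_load n (by simp [hreg, hmem, layout_input, G.inputMem_zero]) (by omega) ?_
  refine wp_const 3 (by omega) ?_
  refine wp_op (n + 3) (by simp [BinOp.eval]) (by omega) ?_
  refine wp_op (n + 2) (by simp [BinOp.eval]) (by omega) ?_
  refine wp_load G.edges.length ?_ (by omega) ?_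
  · simp only [Config.setReg_mem, Config.setReg_reg, Function.update_self, hmem]
    rw [layout_input _ _ _ _ _ _ _ (by omega), hm]
  refine wp_op (n + 3 + G.edges.length) (by simp [BinOp.eval]) (by omega) ?_
  refine wp_op (n + 3 + G.edges.length + 1) (by simp [BinOp.eval]) (by omega) ?_
  refine wp_op (n + 3 + G.edges.length + 2) (by simp [BinOp.eval]) (by omega) ?_
  refine wp_op (n + 3 + G.edges.length + 3) (by simp [BinOp.eval]) (by omega) ?_
  refine wp_load s ?_ (by omega) ?_
  · have h1 : (1 : ℕ) < n + 3 + G.edges.length := by omega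
    simp [hmem, layout_input _ _ _ _ _ _ _ h1, G.inputMem_one]
  refine wp_op (4 * 1 + (n + 3 + G.edges.length + 1)) (by simp [BinOp.eval]) (by omega) ?_
  refine wp_store (4 * 1 + (n + 3 + G.edges.length + 1)) s (by simp) (by simp) ?_
  refine wp_const 1 (by omega) ?_
  refine wp_const 1 (by omega) ?_
  refine wp_const 1 (by omega) ?_
  refine wp_const 1 (by omega) ?_
  have hsize : queueSize J [s] (fun _ => []) = 1 := by simp [queueSize]
  refine wp_skip ⟨[], _, 1, [s], fun _ => [], fun _ => 0, .start, ?_, ?_, by simp [hreg], ?_, ?_, ?_⟩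
  · refine ⟨by simp, by simp, hB, fun v _ hv => ?_, by simp, by simp⟩
    by_cases h : v = s
    · simp [h]
    · simp [h] at hv
  · refine ⟨by simp [hreg], by simp, by simp, by simp, by simp, by simp, by simp, by simp, by simp,
      by simp, by simp, by simp [hreg], fun _ => 0, Function.update (fun _ => 0) 1 (s : ℕ),
      fun _ => 0, fun _ => 0, ?_, by simp [Chain], by simp [Chain], by simp⟩
    simp only [Config.tick_mem, Config.setReg_mem, Config.setMem_mem, hmem, update_layout_one]
  · rw [hsize]
    simp [htime]
  · simp [OutputOk, hout]
  · rw [hsize]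
    simp

end Blocks

/-! ### The word size -/

/-- With `Y = 2 ^ (Nat.log 2 n + 1) > n`, the numbers of vertices and edges and the label bound are
all below `Y ^ (k + 3) = 2 ^ J`. Seven further bits account for the factor 128. -/
theorem fits_of_bounds (k n m : ℕ) (hm : m ≤ n * n) :
    Fits ((k + 10) * (Nat.log 2 n + 1)) ((k + 3) * (Nat.log 2 n + 1)) n m (n * n ^ k + 1) := by
  have hn : n < 2 ^ (Nat.log 2 n + 1) := Nat.lt_pow_succ_log_self (by norm_num) n
  have hJ : 2 ^ ((k + 3) * (Nat.log 2 n + 1)) = (2 ^ (Nat.log 2 n + 1)) ^ (k + 3) := by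
    rw [← pow_mul, mul_comm]
  have hw : (k + 3) * (Nat.log 2 n + 1) + 7 ≤ (k + 10) * (Nat.log 2 n + 1) := by nlinarith
  set Y := 2 ^ (Nat.log 2 n + 1) with hY
  have hY0 : 0 < Y := by positivity
  have h1 : Y ≤ Y ^ (k + 3) := Nat.le_self_pow (by omega) Y
  have h2 : Y ^ 2 ≤ Y ^ (k + 3) := Nat.pow_le_pow_right hY0 (by omega)
  have h3 : Y ^ (k + 1) ≤ Y ^ (k + 2) := Nat.pow_le_pow_right hY0 (by omega)
  refine ⟨?_, ?_, ?_, ?_⟩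
  · rw [hJ]
    omega
  · rw [hJ]
    nlinarith
  · rw [hJ]
    have h4 : n ^ (k + 1) < Y ^ (k + 1) := Nat.pow_lt_pow_left hn (by omega)
    have h5 : Y ^ (k + 1) < Y ^ (k + 3) := Nat.pow_lt_pow_right (by
      rw [hY]
      exact Nat.one_lt_two_pow (by omega)) (by omega)
    rw [pow_succ, mul_comm] at h4
    omega
  · calc 128 * 2 ^ ((k + 3) * (Nat.log 2 n + 1)) = 2 ^ ((k + 3) * (Nat.log 2 n + 1) + 7) := by
          rw [pow_add]
          ring
      _ ≤ _ := Nat.pow_le_pow_right (by norm_num) hw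

end BucketSSSP

open BucketSSSP
theorem mainTheorem2 (k : ℕ) :
    ∃ (P : Program) (C κ : ℕ), ∀ (n : ℕ) (G : WDigraph n) (s : Fin n),
      (∀ u, ∀ v ∈ G.adj u, 1 ≤ G.weight u v ∧ G.weight u v ≤ (n : ℝ≥0) ^ k) →
      ∃ (l : List (Fin n)) (d : Fin n → ℕ∞) (τ : Config),
        CompleteRun G s l d ∧
        G.DistancePreserving (1 / 4) s (fun v => (d v : ℝ≥0∞)) ∧
        l.Nodup ∧ (∀ v, v ∈ l ↔ G.dist s v ≠ ⊤) ∧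
        l.Pairwise (fun u v => d u ≤ d v) ∧
        Exec (κ * (Nat.log 2 n + 1)) G.inputWeights P (G.input s) τ ∧
        τ.out.length = l.length ∧
        (∀ (i : ℕ) (hi : i < l.length), ∃ t x : ℕ,
          τ.out[i]? = some (t, (l[i] : ℕ), x) ∧ d l[i] = (x : ℕ∞) ∧
          t ≤ C * (1 + ((l.take (i + 1)).map G.degree).sum)) ∧
        τ.time ≤ C * (1 + (l.map G.degree).sum) := by
  refine ⟨bucketDijkstra, 100, k + 10, fun n G s hG => ?_⟩
  have hw : ∀ u, ∀ v ∈ G.adj u, 1 ≤ G.weight u v := fun u v hv => (hG u v hv).1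
  have hN : ∀ u, ∀ v ∈ G.adj u, ⌊G.weight u v⌋₊ ≤ n ^ k := fun u v hv =>
    Nat.floor_le_of_le (by exact_mod_cast (hG u v hv).2)
  have hF := fits_of_bounds k n _ G.length_edges_le
  have hwp : Wp ((k + 10) * (Nat.log 2 n + 1)) G.inputWeights bucketDijkstra (fun τ =>
      ∃ l d, CompleteRun G s l d ∧ OutputOk G 100 l d τ.out ∧
        τ.time ≤ 100 * (1 + (l.map G.degree).sum)) (G.input s) := by
    refine wp_seq ((wp_setup hF (by omega) rfl (eq_layout _ _ fun i hi => G.inputMem_of_le s hi)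
      rfl rfl).mono fun σ hσ => ?_)
    refine wp_while (LoopInv G s _ _) (fun N σ hI h => wp_loopBody hw hN le_rfl hF hI h) ?_ hσ
    -- At the exit the current list and the mask are both empty, so no unvisited vertex has a finite
    -- label and the run is complete.
    rintro N σ ⟨l, t, a, cur, L, lab, hrun, hQ, hR, hgo, htime, hout, -⟩ h
    rw [hR.r0, hgo] at h
    have hcur : cur = [] := by
      by_contra hne
      have := hR.pos_iff.mpr hne
      omega
    have hL : ∀ j, L j = [] := by
      intro j
      by_contra hne
      have := (hR.mask j).mpr hne
      rw [show σ.reg 11 = 0 by omega] at this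
      simp at this
    subst hcur
    refine ⟨l, t, ⟨hrun, fun v hv => hQ.eq_top_of_empty hL hv⟩, hout, ?_⟩
    simp only [Config.tick_time]
    omega
  obtain ⟨τ, hexec, l, d, hrun, hout, htime⟩ := hwp
  have hf := hrun.1.facts hw hN
  exact ⟨l, d, τ, hrun, hrun.distancePreserving hf, hf.nodup, hrun.mem_iff hf, hf.sorted, hexec,
    hout.1, hout.2, htime⟩
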